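/- Let $\beta\in(0,1]$, $a\ge 0$ and $b\ge 1$. For $c\in\mathbb{R}$, let $f_c$ be the unique solution of $$f'''+ff''+\beta f'(f'-1)=0,\qquad f(0)=a,\quad f'(0)=b,\quad f''(0)=c,$$ defined on its right maximal interval of existence $[0,T_c)$, $0<T_c\le+\infty$. For $\lambda\in\{0,1\}$, let $(\mathcal P_{\beta;a,b,\lambda})$ be the boundary value problem $$f'''+ff''+\beta f'(f'-1)=0\ \text{ on }[0,+\infty),\qquad f(0)=a,\quad f'(0)=b,\quad f'(t)\to\lambda\ \text{ as }t\to+\infty .$$ Call a function on $[0,+\infty)$ concave-convex (resp. convex-concave) if there is $t_0>0$ such that it is strictly concave (resp. strictly convex) on $[0,t_0]$ and strictly convex (resp. strictly concave) on $[t_0,+\infty)$. There exists $c_*<0$ such that: - if $c<c_*$, then $T_c<+\infty$, i.e. $f_c$ is not defined on the whole interval $[0,+\infty)$, while $T_c=+\infty$ if $c\ge c_*$; - $f_{c_*}$ is a concave solution of $(\mathcal P_{\beta;a,b,0})$, and it is the only solution of $(\mathcal P_{\beta;a,b,0})$; - $f_c$ is a solution of $(\mathcal P_{\beta;a,b,1})$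 for all $c\in(c_*,+\infty)$. Moreover, there exists $c^*\in(c_*,-a(b-1)]$ such that: - $f_c$ is a convex-concave solution of $(\mathcal P_{\beta;a,b,1})$ for all $c\in(0,+\infty)$; - $f_c$ is a concave solution of $(\mathcal P_{\beta;a,b,1})$ for all $c\in[c^*,0]$; - $f_c$ is a concave-convex solution of $(\mathcal P_{\beta;a,b,1})$ for all $c\in(c_*,c^*)$. -/

import Mathlib

open Set Filter Topology

/-- `f` is a solution on the interval `I` of `f''' + f f'' + β f' (f' - 1) = 0`
(derivatives at an endpoint belonging to `I` are one-sided). -/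
def MixedConvection.IsSolutionOn (β : ℝ) (f : ℝ → ℝ) (I : Set ℝ) : Prop :=
  ContDiffOn ℝ 3 f I ∧
    ∀ t ∈ I, iteratedDerivWithin 3 f I t + f t * iteratedDerivWithin 2 f I t
      + β * derivWithin f I t * (derivWithin f I t - 1) = 0

/-- The interval `[0, T)`, where `T` may be `+∞`. -/
def MixedConvection.interval (T : EReal) : Set ℝ := {t : ℝ | 0 ≤ t ∧ (t : EReal) < T}

/-- `f` solves the equation on `[0, T)`, with `f 0 = a`, `f' 0 = b`, `f'' 0 = c`. -/
def MixedConvection.IsShootingOn (β a b c : ℝ) (f : ℝ → ℝ) (T : EReal) : Prop :=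
  0 < T ∧ MixedConvection.IsSolutionOn β f (MixedConvection.interval T) ∧
    f 0 = a ∧ derivWithin f (MixedConvection.interval T) 0 = b ∧
    iteratedDerivWithin 2 f (MixedConvection.interval T) 0 = c

/-- `[0, T)` is the right maximal interval of existence of the initial value problem, and `f` is
its solution there: every solution `g` on some `[0, S)` satisfies `S ≤ T` and `g = f` on `[0, S)`.
This determines `T`, and `f` on `[0, T)`, uniquely. -/
def MixedConvection.IsMaximalShooting (β a b c : ℝ) (f : ℝ → ℝ) (T : EReal) : Prop :=
  MixedConvection.IsShootingOn β a b c f T ∧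
    ∀ (g : ℝ → ℝ) (S : EReal), MixedConvection.IsShootingOn β a b c g S →
      S ≤ T ∧ EqOn g f (MixedConvection.interval S)

/-- The maximal solution of the initial value problem, paired with the right end of its interval
of existence. -/
noncomputable def MixedConvection.shootingPair (β a b c : ℝ) : (ℝ → ℝ) × EReal :=
  Classical.epsilon fun p : (ℝ → ℝ) × EReal =>
    MixedConvection.IsMaximalShooting β a b c p.1 p.2

/-- The shooting solution `f_c`. -/
noncomputable def MixedConvection.shoot (β a b c : ℝ) : ℝ → ℝ :=
  (MixedConvection.shootingPair β a b c).1

/-- The right end `T_c` of the maximal interval of existence `[0, T_c)` of `f_c`. -/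
noncomputable def MixedConvection.lifespan (β a b c : ℝ) : EReal :=
  (MixedConvection.shootingPair β a b c).2

/-- `f` is a solution of the boundary value problem: the equation holds on `[0, +∞)`, `f 0 = a`,
`f' 0 = b` and `f' t → l` as `t → +∞`. -/
def MixedConvection.IsBVPSolution (β a b l : ℝ) (f : ℝ → ℝ) : Prop :=
  MixedConvection.IsSolutionOn β f (Ici 0) ∧ f 0 = a ∧ derivWithin f (Ici 0) 0 = b ∧
    Tendsto (derivWithin f (Ici 0)) atTop (𝓝 l)

/-- `f` is (strictly) concave on `[0, t₀]` and (strictly) convex on `[t₀, +∞)`, some `t₀ > 0`. -/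
def MixedConvection.IsConcaveConvex (f : ℝ → ℝ) : Prop :=
  ∃ t₀ : ℝ, 0 < t₀ ∧ StrictConcaveOn ℝ (Icc 0 t₀) f ∧ StrictConvexOn ℝ (Ici t₀) f

/-- `f` is (strictly) convex on `[0, t₀]` and (strictly) concave on `[t₀, +∞)`, some `t₀ > 0`. -/
def MixedConvection.IsConvexConcave (f : ℝ → ℝ) : Prop :=
  ∃ t₀ : ℝ, 0 < t₀ ∧ StrictConvexOn ℝ (Icc 0 t₀) f ∧ StrictConcaveOn ℝ (Ici t₀) f

/-!
Write `p = f'` and `q = f''`, so that `(f, p, q)` is a trajectory of a polynomial vector field on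
`ℝ³`. Truncating this field makes it bounded and globally Lipschitz; Picard–Lindelöf and Grönwall
then give the maximal solution, its uniqueness, the fact that it is unbounded if it is not global,
and its continuous dependence on `c` (`exists_family`).

For one trajectory, three quantities carry the qualitative analysis.
* The energy `q² / 2 + β (p³ / 3 - p² / 2)` decreases while `p ≥ 0`. Hence a solution with `p > 0`
  is bounded on bounded intervals, so global (`eq_top`), and a solution whose energy becomes
  negative can neither reach `p = 0` nor satisfy `p, q → 0` (`regular_of_energy_neg`).
* `φ = q + f (p - 1)` satisfies `φ' = (1 - β) p (p - 1)`. Here `β ≤ 1` enters: `f'` crosses the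
  value `1` at most once (`lt_one_of_crossing`), and never if `c ≥ -a (b - 1)` (`one_lt`).
* `χ = q + f (p - κ)`, for suitable constants `κ`, shows that `f' → l` with `f → ∞` is possible
  only for `l = 1` (`limit_eq_one`).

Moreover `f''` decreases through its zeros where `f' > 1` and increases through them where
`0 < f' < 1`. It follows (`classification`, `regular_of_ge`) that a solution is of one of three
kinds: `f'` reaches `0`, and then the solution blows up in finite time (`lt_top_of_hit_zero`); or
it is bounded and strictly concave with `f' → 0` (critical); or `f' → 1` (regular), with the
announced shape.

Two solutions with `c₁ < c₂ < 0` are compared at equal values of `f'` (`comparison`): parametrized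
by the decreasing slope `f'`, the differences of `f` and of `f''` obey a cooperative system, so the
solution with the smaller initial `f''` keeps the smaller `f''`, and the difference of the
quantities `q + f p` does not decrease. Therefore every `c` below a non-regular value gives
blow-up (`blowUp_of_lt_of_not_regular`); in particular at most one value is critical, since
`q + f p → 0` along critical solutions. Similarly, among the `c ≤ 0`, those with `f' ≥ 1` form an
up-closed set (`one_le_of_lt`).

Finally, both blow-up and regularity are open conditions on `c`, blow-up occurs for very negative
`c` and regularity for all `c ≥ 0`. So the supremum of the non-regular values is critical, and it is
`cLow` (`exists_critical`); `cHigh` is the least `c ≤ 0` for which `f' ≥ 1`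
(`exists_concave_threshold`).
-/

namespace MixedConvection

/-! ### The first-order system -/

/-- The vector field on `ℝ³` whose trajectories are the triples `(f, f', f'')`, for `f` a solution
of `f''' + f f'' + β f' (f' - 1) = 0`. -/
def field (β : ℝ) (x : ℝ × ℝ × ℝ) : ℝ × ℝ × ℝ :=
  (x.2.1, x.2.2, -(x.1 * x.2.2) - β * x.2.1 * (x.2.1 - 1))

/-- `X` is a trajectory of `field β` on `[0, T)`; the derivative at `0` is one-sided. -/
def IsFlow (β : ℝ) (X : ℝ → ℝ × ℝ × ℝ) (T : EReal) : Prop :=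
  ∀ t ∈ interval T, HasDerivWithinAt X (field β (X t)) (Ici 0) t

theorem mem_interval_of_le {T : EReal} {s t : ℝ} (ht : t ∈ interval T) (hs : 0 ≤ s)
    (hst : s ≤ t) : s ∈ interval T :=
  ⟨hs, lt_of_le_of_lt (by exact_mod_cast hst) ht.2⟩

theorem interval_top : interval ⊤ = Ici 0 := by
  ext t; simp [interval, EReal.coe_lt_top]

theorem interval_mem_nhdsWithin {T : EReal} {t : ℝ} (ht : t ∈ interval T) :
    interval T ∈ 𝓝[Ici 0] t := by
  have h : {s : ℝ | (s : EReal) < T} ∈ 𝓝 t :=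
    (isOpen_Iio.preimage continuous_coe_real_ereal).mem_nhds ht.2
  filter_upwards [self_mem_nhdsWithin, mem_nhdsWithin_of_mem_nhds h] with s hs hs'
  exact ⟨hs, hs'⟩

theorem interval_subset_Ici (T : EReal) : interval T ⊆ Ici 0 := fun _ h => h.1

theorem hasDerivWithinAt_interval_iff {E : Type*} [NormedAddCommGroup E] [NormedSpace ℝ E]
    {T : EReal} {t : ℝ} (ht : t ∈ interval T) {X : ℝ → E} {v : E} :
    HasDerivWithinAt X v (interval T) t ↔ HasDerivWithinAt X v (Ici 0) t :=
  ⟨fun h => h.mono_of_mem_nhdsWithin (interval_mem_nhdsWithin ht),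
    fun h => h.mono (interval_subset_Ici T)⟩

theorem zero_mem_interval {T : EReal} (hT : 0 < T) : (0 : ℝ) ∈ interval T :=
  ⟨le_rfl, by simpa using hT⟩

theorem uniqueDiffOn_interval (T : EReal) : UniqueDiffOn ℝ (interval T) := by
  intro t ht
  exact ((uniqueDiffOn_Ici (0 : ℝ)) t ht.1).mono_nhds
    (by rw [nhdsWithin_le_iff]; exact interval_mem_nhdsWithin ht)

/-- The interval `[0, T)` has no largest point. -/
theorem exists_gt_mem_interval {T : EReal} {t : ℝ} (ht : t ∈ interval T) :
    ∃ s : ℝ, t < s ∧ s ∈ interval T := by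
  obtain ⟨s, hs1, hs2⟩ := EReal.lt_iff_exists_real_btwn.1 ht.2
  exact ⟨s, by exact_mod_cast hs1, ht.1.trans (by exact_mod_cast hs1.le), hs2⟩

theorem IsFlow.continuousOn {β : ℝ} {X : ℝ → ℝ × ℝ × ℝ} {T : EReal} (h : IsFlow β X T) :
    ContinuousOn X (interval T) :=
  fun t ht => (h t ht).continuousWithinAt.mono (interval_subset_Ici T)

theorem contDiff_field (β : ℝ) : ContDiff ℝ 1 (field β) := by
  unfold field; fun_prop

/-! ### Globally Lipschitz vector fields -/

/-- A bounded, globally Lipschitz vector field has trajectories defined for all positive times. -/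
theorem exists_trajectory_of_lipschitz_of_bounded {E : Type*} [NormedAddCommGroup E]
    [NormedSpace ℝ E] [CompleteSpace E] {g : E → E} {K M : NNReal} (hK : LipschitzWith K g)
    (hM : ∀ x, ‖g x‖ ≤ M) (x₀ : E) :
    ∃ x : ℝ → E, x 0 = x₀ ∧ ∀ t, 0 ≤ t → HasDerivWithinAt x (g (x t)) (Ici 0) t := by
  have key : ∀ n : ℕ, ∃ α : ℝ → E, α 0 = x₀ ∧
      ∀ t ∈ Icc (0 : ℝ) n, HasDerivWithinAt α (g (α t)) (Icc 0 (n : ℝ)) t := by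
    intro n
    have hpl : IsPicardLindelof (fun _ : ℝ => g) (tmin := 0) (tmax := n)
        ⟨0, le_rfl, Nat.cast_nonneg n⟩ x₀ (M * n) 0 M K :=
      { lipschitzOnWith := fun t _ => hK.lipschitzOnWith
        continuousOn := fun x _ => continuousOn_const
        norm_le := fun t _ x _ => hM x
        mul_max_le := by simp }
    exact hpl.exists_eq_forall_mem_Icc_hasDerivWithinAt₀
  choose α hα0 hα using key
  have huniq : ∀ m n : ℕ, m ≤ n → EqOn (α m) (α n) (Icc 0 (m : ℝ)) := by
    intro m n hmn
    have hsub : Icc (0 : ℝ) m ⊆ Icc 0 n := Icc_subset_Icc_right (by exact_mod_cast hmn)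
    have side : ∀ k : ℕ, m ≤ k → ∀ t ∈ Ico (0 : ℝ) m,
        HasDerivWithinAt (α k) (g (α k t)) (Ici t) t := by
      intro k hk t ht
      have hk' : (m : ℝ) ≤ k := by exact_mod_cast hk
      refine (hα k t ⟨ht.1, ht.2.le.trans hk'⟩).mono_of_mem_nhdsWithin ?_
      filter_upwards [Icc_mem_nhdsGE ht.2] with s hs using ⟨ht.1.trans hs.1, hs.2.trans hk'⟩
    refine ODE_solution_unique (v := fun _ => g) (K := K) (fun _ => hK) ?_ (side m le_rfl) ?_
      (side n hmn) ?_
    · exact fun t ht => (hα m t ht).continuousWithinAt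
    · exact fun t ht => (hα n t (hsub ht)).continuousWithinAt.mono hsub
    · rw [hα0, hα0]
  refine ⟨fun t => α (⌊t⌋₊ + 1) t, hα0 _, fun t ht => ?_⟩
  set N := ⌊t⌋₊ + 2 with hN
  have htN : t < N := by
    have := Nat.lt_floor_add_one t
    rw [hN]; push_cast; linarith
  have hEq : ∀ s : ℝ, 0 ≤ s → s < (⌊t⌋₊ + 1 : ℕ) → α (⌊s⌋₊ + 1) s = α N s := by
    intro s hs hs'
    refine huniq _ _ ?_ ⟨hs, by push_cast; exact (Nat.lt_floor_add_one s).le⟩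
    have : ⌊s⌋₊ < ⌊t⌋₊ + 1 := (Nat.floor_lt hs).2 hs'
    omega
  have ht1 : t < (⌊t⌋₊ + 1 : ℕ) := by push_cast; exact Nat.lt_floor_add_one t
  have hd : HasDerivWithinAt (α N) (g (α N t)) (Ici 0) t := by
    refine (hα N t ⟨ht, htN.le⟩).mono_of_mem_nhdsWithin ?_
    filter_upwards [self_mem_nhdsWithin, mem_nhdsWithin_of_mem_nhds (Iio_mem_nhds htN)]
      with s hs hs' using ⟨hs, le_of_lt hs'⟩
  simp only [hEq t ht ht1]
  refine hd.congr_of_eventuallyEq ?_ (hEq t ht ht1)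
  filter_upwards [self_mem_nhdsWithin, mem_nhdsWithin_of_mem_nhds (Iio_mem_nhds ht1)]
    with s hs hs' using hEq s hs hs'

/-- On each ball, `field β` agrees with a bounded, globally Lipschitz vector field. -/
theorem exists_truncation (β R : ℝ) : ∃ (g : ℝ × ℝ × ℝ → ℝ × ℝ × ℝ) (K M : NNReal),
    LipschitzWith K g ∧ (∀ x, ‖g x‖ ≤ M) ∧ ∀ x, ‖x‖ ≤ R → g x = field β x := by
  rcases lt_or_ge R 0 with hR | hR
  · exact ⟨fun _ => 0, 0, 0, LipschitzWith.const 0, by simp,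
      fun x hx => absurd (hx.trans_lt hR) (not_lt.2 (norm_nonneg x))⟩
  have hI : -R ≤ R := by linarith
  let π : ℝ → ℝ := fun s => projIcc (-R) R hI s
  have hπ : LipschitzWith 1 π :=
    (LipschitzWith.subtype_val _).comp (LipschitzWith.projIcc hI) |>.weaken (by simp)
  let P : ℝ × ℝ × ℝ → ℝ × ℝ × ℝ := fun x => (π x.1, π x.2.1, π x.2.2)
  have hP : LipschitzWith 1 P := by
    have h1 := hπ.comp (LipschitzWith.prod_fst (α := ℝ) (β := ℝ × ℝ))
    have h2 := hπ.comp ((LipschitzWith.prod_fst (α := ℝ) (β := ℝ)).comp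
      (LipschitzWith.prod_snd (α := ℝ) (β := ℝ × ℝ)))
    have h3 := hπ.comp ((LipschitzWith.prod_snd (α := ℝ) (β := ℝ)).comp
      (LipschitzWith.prod_snd (α := ℝ) (β := ℝ × ℝ)))
    exact (h1.prodMk (h2.prodMk h3)).weaken (by simp)
  let B : Set (ℝ × ℝ × ℝ) := Icc (-R) R ×ˢ (Icc (-R) R ×ˢ Icc (-R) R)
  have hB : IsCompact B := isCompact_Icc.prod (isCompact_Icc.prod isCompact_Icc)
  have hPB : ∀ x, P x ∈ B := fun x => ⟨Subtype.prop _, Subtype.prop _, Subtype.prop _⟩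
  obtain ⟨K, hK⟩ := ((contDiff_field β).locallyLipschitz.locallyLipschitzOn
    (s := B)).exists_lipschitzOnWith_of_compact hB
  obtain ⟨M, hM⟩ := (hB.image (contDiff_field β).continuous).isBounded.exists_norm_le
  refine ⟨field β ∘ P, K * 1, M.toNNReal, ?_, fun x => ?_, fun x hx => ?_⟩
  · rw [← lipschitzOnWith_univ]
    exact hK.comp hP.lipschitzOnWith (fun x _ => hPB x)
  · exact (hM _ ⟨P x, hPB x, rfl⟩).trans (Real.le_coe_toNNReal M)
  · have h1 : |x.1| ≤ R := (norm_fst_le x).trans hx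
    have h2 : |x.2.1| ≤ R := (norm_fst_le x.2).trans ((norm_snd_le x).trans hx)
    have h3 : |x.2.2| ≤ R := (norm_snd_le x.2).trans ((norm_snd_le x).trans hx)
    have hπx : ∀ s : ℝ, |s| ≤ R → π s = s := fun s hs => by
      simp only [π, projIcc_of_mem hI (abs_le.1 hs)]
    simp only [Function.comp, P, hπx _ h1, hπx _ h2, hπx _ h3]

/-! ### Trajectories of the vector field -/

/-- A trajectory stays bounded on compact parts of its interval of definition. -/
theorem IsFlow.exists_bound {β : ℝ} {X : ℝ → ℝ × ℝ × ℝ} {T : EReal} (h : IsFlow β X T) {t : ℝ}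
    (ht : t ∈ interval T) : ∃ R, ∀ s ∈ Icc 0 t, ‖X s‖ ≤ R := by
  have hc : ContinuousOn X (Icc 0 t) :=
    h.continuousOn.mono fun s hs => mem_interval_of_le ht hs.1 hs.2
  obtain ⟨R, hR⟩ := (isCompact_Icc.image_of_continuousOn hc).isBounded.exists_norm_le
  exact ⟨R, fun s hs => hR _ ⟨s, hs, rfl⟩⟩

/-- Two trajectories of one globally Lipschitz vector field separate at most exponentially. -/
theorem dist_trajectory_le {E : Type*} [NormedAddCommGroup E] [NormedSpace ℝ E] {g : E → E}
    {K : NNReal} (hK : LipschitzWith K g) {x y : ℝ → E} {t : ℝ}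
    (hx : ∀ s ∈ Icc 0 t, HasDerivWithinAt x (g (x s)) (Ici 0) s)
    (hy : ∀ s ∈ Icc 0 t, HasDerivWithinAt y (g (y s)) (Ici 0) s) :
    ∀ s ∈ Icc 0 t, dist (x s) (y s) ≤ dist (x 0) (y 0) * Real.exp (K * s) := by
  intro s hs
  have hsub : Icc 0 t ⊆ Ici (0 : ℝ) := fun _ h => h.1
  have := dist_le_of_trajectories_ODE (v := fun _ => g) (K := K) (a := 0) (b := t)
    (fun _ => hK) (fun r hr => (hx r hr).continuousWithinAt.mono hsub)
    (fun r hr => (hx r (Ico_subset_Icc_self hr)).mono (Ici_subset_Ici.2 hr.1))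
    (fun r hr => (hy r hr).continuousWithinAt.mono hsub)
    (fun r hr => (hy r (Ico_subset_Icc_self hr)).mono (Ici_subset_Ici.2 hr.1)) le_rfl s hs
  simpa using this

theorem IsFlow.eqOn {β : ℝ} {X Y : ℝ → ℝ × ℝ × ℝ} {T S : EReal} (hX : IsFlow β X T)
    (hY : IsFlow β Y S) (h0 : X 0 = Y 0) {t : ℝ} (htT : t ∈ interval T) (htS : t ∈ interval S) :
    X t = Y t := by
  obtain ⟨R₁, h1⟩ := hX.exists_bound htT
  obtain ⟨R₂, h2⟩ := hY.exists_bound htS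
  obtain ⟨g, K, M, hK, -, hg⟩ := exists_truncation β (max R₁ R₂)
  have := dist_trajectory_le hK (x := X) (y := Y) (t := t)
    (fun s hs => by
      rw [hg _ ((h1 s hs).trans (le_max_left _ _))]
      exact hX s (mem_interval_of_le htT hs.1 hs.2))
    (fun s hs => by
      rw [hg _ ((h2 s hs).trans (le_max_right _ _))]
      exact hY s (mem_interval_of_le htS hs.1 hs.2)) t ⟨htT.1, le_rfl⟩
  rw [h0, dist_self, zero_mul] at this
  exact dist_le_zero.1 this

/-- A trajectory of a truncated field that stays inside the region where nothing was truncated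
is a trajectory of `field β`, on a slightly longer interval. -/
theorem exists_isFlow_of_truncation {β R : ℝ} {g : ℝ × ℝ × ℝ → ℝ × ℝ × ℝ}
    (hg : ∀ x, ‖x‖ ≤ R → g x = field β x) {x : ℝ → ℝ × ℝ × ℝ}
    (hx : ∀ t, 0 ≤ t → HasDerivWithinAt x (g (x t)) (Ici 0) t) {t : ℝ} (ht : 0 ≤ t)
    (hR : ∀ s ∈ Icc 0 t, ‖x s‖ < R) : ∃ S : ℝ, t < S ∧ IsFlow β x S := by
  have h1 : ∀ᶠ s in 𝓝[Ici 0] t, ‖x s‖ < R :=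
    (hx t ht).continuousWithinAt.norm.eventually_lt continuousWithinAt_const (hR t ⟨ht, le_rfl⟩)
  have h2 : ∀ᶠ s in 𝓝[Ici t] t, ‖x s‖ < R := h1.filter_mono (nhdsWithin_mono _ (Ici_subset_Ici.2 ht))
  obtain ⟨S, hS, hS'⟩ := mem_nhdsGE_iff_exists_Ico_subset.1 h2
  refine ⟨S, hS, fun s hs => ?_⟩
  have hlt : ‖x s‖ < R := by
    rcases le_or_gt s t with hst | hst
    · exact hR s ⟨hs.1, hst⟩
    · exact hS' ⟨hst.le, by exact_mod_cast hs.2⟩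
  rw [← hg _ hlt.le]
  exact hx s hs.1

theorem exists_isFlow (β : ℝ) (x₀ : ℝ × ℝ × ℝ) :
    ∃ (X : ℝ → ℝ × ℝ × ℝ) (S : EReal), 0 < S ∧ IsFlow β X S ∧ X 0 = x₀ := by
  obtain ⟨g, K, M, hK, hM, hg⟩ := exists_truncation β (‖x₀‖ + 1)
  obtain ⟨x, hx0, hx⟩ := exists_trajectory_of_lipschitz_of_bounded hK hM x₀
  obtain ⟨S, hS, hfl⟩ := exists_isFlow_of_truncation hg hx le_rfl (fun s hs => by
    obtain rfl : s = 0 := le_antisymm hs.2 hs.1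
    rw [hx0]; linarith)
  exact ⟨x, S, by exact_mod_cast hS, hfl, hx0⟩

/-- A bounded trajectory on a bounded interval can be continued. -/
theorem IsFlow.exists_extension {β : ℝ} {X : ℝ → ℝ × ℝ × ℝ} {T : ℝ} (hT : 0 < T)
    (hX : IsFlow β X T) {R : ℝ} (hR : ∀ t ∈ interval T, ‖X t‖ ≤ R) :
    ∃ (Y : ℝ → ℝ × ℝ × ℝ) (S : EReal), T < S ∧ IsFlow β Y S ∧ Y 0 = X 0 := by
  obtain ⟨g, K, M, hK, hM, hg⟩ := exists_truncation β (R + 1)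
  obtain ⟨x, hx0, hx⟩ := exists_trajectory_of_lipschitz_of_bounded hK hM (X 0)
  have hEq : ∀ t ∈ Ico 0 T, ‖x t‖ ≤ R := by
    intro t ht
    have htT : t ∈ interval T := ⟨ht.1, by exact_mod_cast ht.2⟩
    have := dist_trajectory_le hK (x := x) (y := X) (t := t) (fun s hs => hx s hs.1)
      (fun s hs => by
        have hs' := mem_interval_of_le htT hs.1 hs.2
        rw [hg _ ((hR s hs').trans (by linarith))]
        exact hX s hs') t ⟨ht.1, le_rfl⟩
    rw [hx0, dist_self, zero_mul] at this
    rw [dist_le_zero.1 this]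
    exact hR t htT
  have hcont : ContinuousWithinAt x (Ico 0 T) T :=
    (hx T hT.le).continuousWithinAt.mono fun s hs => hs.1
  have hxT : ‖x T‖ ≤ R := by
    have : NeBot (𝓝[Ico 0 T] T) := by
      rw [← mem_closure_iff_nhdsWithin_neBot, closure_Ico hT.ne]
      exact ⟨hT.le, le_rfl⟩
    exact le_of_tendsto hcont.norm (by filter_upwards [self_mem_nhdsWithin] with s hs using hEq s hs)
  obtain ⟨S, hS, hfl⟩ := exists_isFlow_of_truncation hg hx hT.le (fun s hs => by
    rcases hs.2.lt_or_eq with h | rfl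
    · linarith [hEq s ⟨hs.1, h⟩]
    · linarith)
  exact ⟨x, S, by exact_mod_cast hS, hfl, hx0⟩

/-- Continuous dependence on the initial data, on compact time intervals. -/
theorem IsFlow.exists_isFlow_near {β : ℝ} {X : ℝ → ℝ × ℝ × ℝ} {T : EReal} (hX : IsFlow β X T)
    {t : ℝ} (ht : t ∈ interval T) {ε : ℝ} (hε : 0 < ε) :
    ∃ δ > 0, ∀ y₀, dist y₀ (X 0) < δ → ∃ (Y : ℝ → ℝ × ℝ × ℝ) (S : EReal), t < S ∧ IsFlow β Y S ∧
      Y 0 = y₀ ∧ ∀ s ∈ Icc 0 t, dist (Y s) (X s) < ε := by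
  obtain ⟨R, hR⟩ := hX.exists_bound ht
  obtain ⟨g, K, M, hK, hM, hg⟩ := exists_truncation β (R + 1)
  refine ⟨min ε 1 * Real.exp (-(K * t)), by positivity, fun y₀ hy₀ => ?_⟩
  obtain ⟨y, hy0, hy⟩ := exists_trajectory_of_lipschitz_of_bounded hK hM y₀
  have hd : ∀ s ∈ Icc 0 t, dist (y s) (X s) < min ε 1 := by
    intro s hs
    have := dist_trajectory_le hK (x := y) (y := X) (t := t) (fun s hs => hy s hs.1)
      (fun s hs => by
        rw [hg _ ((hR s hs).trans (by linarith))]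
        exact hX s (mem_interval_of_le ht hs.1 hs.2)) s hs
    rw [hy0] at this
    calc dist (y s) (X s) ≤ dist y₀ (X 0) * Real.exp (K * s) := this
      _ ≤ dist y₀ (X 0) * Real.exp (K * t) := by
          gcongr
          exact hs.2
      _ < min ε 1 * Real.exp (-(K * t)) * Real.exp (K * t) := by gcongr
      _ = min ε 1 := by rw [mul_assoc, ← Real.exp_add]; simp
  obtain ⟨S, hS, hfl⟩ := exists_isFlow_of_truncation hg hy ht.1 (fun s hs => by
    have h1 := (hd s hs).trans_le (min_le_right _ _)
    have h2 := hR s hs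
    have h3 : ‖y s‖ ≤ ‖X s‖ + dist (y s) (X s) := by
      rw [dist_eq_norm]; exact norm_le_norm_add_norm_sub' _ _
    linarith)
  exact ⟨y, S, by exact_mod_cast hS, hfl, hy0, fun s hs => (hd s hs).trans_le (min_le_left _ _)⟩

/-- Gluing all trajectories issued from `x₀` gives one on the longest possible interval. -/
theorem exists_maximal_isFlow (β : ℝ) (x₀ : ℝ × ℝ × ℝ) :
    ∃ (X : ℝ → ℝ × ℝ × ℝ) (T : EReal), 0 < T ∧ IsFlow β X T ∧ X 0 = x₀ ∧
      ∀ (Y : ℝ → ℝ × ℝ × ℝ) (S : EReal), IsFlow β Y S → Y 0 = x₀ → S ≤ T := by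
  classical
  let 𝒮 : Set EReal := {S | ∃ X : ℝ → ℝ × ℝ × ℝ, IsFlow β X S ∧ X 0 = x₀}
  obtain ⟨X₀, S₀, hS₀, hX₀, hX₀0⟩ := exists_isFlow β x₀
  have hpos : 0 < sSup 𝒮 := hS₀.trans_le (le_sSup ⟨X₀, hX₀, hX₀0⟩)
  have key : ∀ t ∈ interval (sSup 𝒮), ∃ (X : ℝ → ℝ × ℝ × ℝ) (S : EReal), t ∈ interval S ∧
      IsFlow β X S ∧ X 0 = x₀ := by
    intro t ht
    obtain ⟨S, ⟨X, hX, hX0⟩, hS⟩ := lt_sSup_iff.1 ht.2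
    exact ⟨X, S, ⟨ht.1, hS⟩, hX, hX0⟩
  choose! Z S hZS hZ hZ0 using key
  have hglue : ∀ t ∈ interval (sSup 𝒮), ∀ s ∈ interval (S t), Z s s = Z t s := by
    intro t ht s hs
    have hs' : s ∈ interval (sSup 𝒮) :=
      ⟨hs.1, hs.2.trans_le (le_sSup ⟨Z t, hZ t ht, hZ0 t ht⟩)⟩
    exact (hZ s hs').eqOn (hZ t ht) ((hZ0 s hs').trans (hZ0 t ht).symm) (hZS s hs') hs
  refine ⟨fun t => Z t t, sSup 𝒮, hpos, fun t ht => ?_, hZ0 0 (zero_mem_interval hpos),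
    fun Y S hY hY0 => le_sSup ⟨Y, hY, hY0⟩⟩
  refine (hZ t ht t (hZS t ht)).congr_of_eventuallyEq ?_ rfl
  filter_upwards [interval_mem_nhdsWithin (hZS t ht)] with s hs using hglue t ht s hs

/-! ### Third-order equation and first-order system -/

theorem IsFlow.components {β : ℝ} {X : ℝ → ℝ × ℝ × ℝ} {T : EReal} (h : IsFlow β X T) {t : ℝ}
    (ht : t ∈ interval T) :
    HasDerivWithinAt (fun s => (X s).1) (X t).2.1 (Ici 0) t ∧
    HasDerivWithinAt (fun s => (X s).2.1) (X t).2.2 (Ici 0) t ∧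
    HasDerivWithinAt (fun s => (X s).2.2)
      (-((X t).1 * (X t).2.2) - β * (X t).2.1 * ((X t).2.1 - 1)) (Ici 0) t := by
  have h1 := (h t ht)
  have h2 : HasDerivWithinAt (fun s => (X s).2) (field β (X t)).2 (Ici 0) t :=
    (hasFDerivAt_snd (𝕜 := ℝ) (p := X t)).comp_hasDerivWithinAt t h1
  exact ⟨(ContinuousLinearMap.fst ℝ ℝ (ℝ × ℝ)).hasFDerivAt.comp_hasDerivWithinAt t h1,
    (ContinuousLinearMap.fst ℝ ℝ ℝ).hasFDerivAt.comp_hasDerivWithinAt t h2,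
    (ContinuousLinearMap.snd ℝ ℝ ℝ).hasFDerivAt.comp_hasDerivWithinAt t h2⟩

/-- The derivatives, within the interval of definition, of the first component of a
trajectory. -/
theorem IsFlow.derivatives {β : ℝ} {X : ℝ → ℝ × ℝ × ℝ} {T : EReal} (h : IsFlow β X T)
    {f : ℝ → ℝ} (hf : EqOn f (fun t => (X t).1) (interval T)) {t : ℝ} (ht : t ∈ interval T) :
    derivWithin f (interval T) t = (X t).2.1 ∧
    iteratedDerivWithin 2 f (interval T) t = (X t).2.2 ∧
    iteratedDerivWithin 3 f (interval T) t =
      -((X t).1 * (X t).2.2) - β * (X t).2.1 * ((X t).2.1 - 1) := by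
  have hu := uniqueDiffOn_interval T
  have h1 : ∀ s ∈ interval T, derivWithin f (interval T) s = (X s).2.1 := fun s hs =>
    (((hasDerivWithinAt_interval_iff hs).2 (h.components hs).1).congr hf (hf hs)).derivWithin
      (hu s hs)
  have h2 : ∀ s ∈ interval T, iteratedDerivWithin 2 f (interval T) s = (X s).2.2 := by
    intro s hs
    rw [iteratedDerivWithin_succ, iteratedDerivWithin_one, derivWithin_congr h1 (h1 s hs)]
    exact ((hasDerivWithinAt_interval_iff hs).2 (h.components hs).2.1).derivWithin (hu s hs)
  refine ⟨h1 t ht, h2 t ht, ?_⟩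
  rw [iteratedDerivWithin_succ, derivWithin_congr h2 (h2 t ht)]
  exact ((hasDerivWithinAt_interval_iff ht).2 (h.components ht).2.2).derivWithin (hu t ht)

theorem IsFlow.isShootingOn {β a b c : ℝ} {X : ℝ → ℝ × ℝ × ℝ} {T : EReal} (hT : 0 < T)
    (h : IsFlow β X T) (h0 : X 0 = (a, b, c)) {f : ℝ → ℝ}
    (hf : EqOn f (fun t => (X t).1) (interval T)) : IsShootingOn β a b c f T := by
  have h0T := zero_mem_interval hT
  have hu := uniqueDiffOn_interval T
  have hd1 : ∀ s ∈ interval T, HasDerivWithinAt f (X s).2.1 (interval T) s := fun s hs =>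
    ((hasDerivWithinAt_interval_iff hs).2 (h.components hs).1).congr hf (hf hs)
  have hd2 : ∀ s ∈ interval T,
      HasDerivWithinAt (fun s => (X s).2.1) (X s).2.2 (interval T) s := fun s hs =>
    (hasDerivWithinAt_interval_iff hs).2 (h.components hs).2.1
  have hd3 : ∀ s ∈ interval T, HasDerivWithinAt (fun s => (X s).2.2)
      (-((X s).1 * (X s).2.2) - β * (X s).2.1 * ((X s).2.1 - 1)) (interval T) s := fun s hs =>
    (hasDerivWithinAt_interval_iff hs).2 (h.components hs).2.2
  have hcX := h.continuousOn
  have hC1 : ContDiffOn ℝ 1 (fun s => (X s).2.2) (interval T) := by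
    rw [contDiffOn_one_iff_derivWithin hu]
    refine ⟨fun s hs => (hd3 s hs).differentiableWithinAt, ?_⟩
    refine ContinuousOn.congr (f := fun s =>
      -((X s).1 * (X s).2.2) - β * (X s).2.1 * ((X s).2.1 - 1)) ?_
      (fun s hs => (hd3 s hs).derivWithin (hu s hs))
    fun_prop
  have hC2 : ContDiffOn ℝ 2 (fun s => (X s).2.1) (interval T) := by
    rw [show (2 : WithTop ℕ∞) = 1 + 1 from rfl, contDiffOn_succ_iff_derivWithin hu]
    refine ⟨fun s hs => (hd2 s hs).differentiableWithinAt, by simp, ?_⟩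
    exact hC1.congr (fun s hs => (hd2 s hs).derivWithin (hu s hs))
  have hC3 : ContDiffOn ℝ 3 f (interval T) := by
    rw [show (3 : WithTop ℕ∞) = 2 + 1 from rfl, contDiffOn_succ_iff_derivWithin hu]
    refine ⟨fun s hs => (hd1 s hs).differentiableWithinAt, by simp, ?_⟩
    exact hC2.congr (fun s hs => (hd1 s hs).derivWithin (hu s hs))
  refine ⟨hT, ⟨hC3, fun t ht => ?_⟩, ?_, ?_, ?_⟩
  · obtain ⟨e1, e2, e3⟩ := h.derivatives hf ht
    rw [e1, e2, e3, hf ht]; ring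
  · simp only [hf h0T, h0]
  · rw [(h.derivatives hf h0T).1, h0]
  · rw [(h.derivatives hf h0T).2.1, h0]

theorem IsShootingOn.exists_isFlow {β a b c : ℝ} {f : ℝ → ℝ} {T : EReal}
    (h : IsShootingOn β a b c f T) :
    ∃ X : ℝ → ℝ × ℝ × ℝ, IsFlow β X T ∧ X 0 = (a, b, c) ∧ ∀ t, (X t).1 = f t := by
  obtain ⟨hT, ⟨hC, heq⟩, h0, h1, h2⟩ := h
  have hu := uniqueDiffOn_interval T
  have hd : ∀ m : ℕ, m < 3 → ∀ t ∈ interval T,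
      HasDerivWithinAt (iteratedDerivWithin m f (interval T))
        (iteratedDerivWithin (m + 1) f (interval T) t) (interval T) t := by
    intro m hm t ht
    rw [iteratedDerivWithin_succ]
    exact ((hC.differentiableOn_iteratedDerivWithin (by exact_mod_cast hm) hu) t
      ht).hasDerivWithinAt
  refine ⟨fun t => (f t, derivWithin f (interval T) t, iteratedDerivWithin 2 f (interval T) t),
    fun t ht => ?_, by simp only [h0, h1, h2], fun t => rfl⟩
  rw [← hasDerivWithinAt_interval_iff ht]
  have d0 := hd 0 (by norm_num) t ht
  have d1 := hd 1 (by norm_num) t ht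
  have d2 := hd 2 (by norm_num) t ht
  rw [iteratedDerivWithin_zero] at d0
  simp only [zero_add, Nat.reduceAdd, iteratedDerivWithin_one] at d0 d1 d2
  have e3 : iteratedDerivWithin 3 f (interval T) t =
      -(f t * iteratedDerivWithin 2 f (interval T) t)
        - β * derivWithin f (interval T) t * (derivWithin f (interval T) t - 1) := by
    linarith [heq t ht]
  rw [e3] at d2
  exact d0.prodMk (d1.prodMk d2)

theorem exists_isMaximalShooting (β a b c : ℝ) :
    ∃ p : (ℝ → ℝ) × EReal, IsMaximalShooting β a b c p.1 p.2 := by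
  obtain ⟨X, T, hT, hX, hX0, hmax⟩ := exists_maximal_isFlow β (a, b, c)
  refine ⟨(fun t => (X t).1, T), hX.isShootingOn hT hX0 fun _ _ => rfl, fun g S hg => ?_⟩
  obtain ⟨Y, hY, hY0, hYg⟩ := hg.exists_isFlow
  have hST := hmax Y S hY hY0
  refine ⟨hST, fun t ht => ?_⟩
  rw [← hYg t, hY.eqOn hX (hY0.trans hX0.symm) ht ⟨ht.1, ht.2.trans_le hST⟩]

theorem isMaximalShooting_shoot (β a b c : ℝ) :
    IsMaximalShooting β a b c (shoot β a b c) (lifespan β a b c) :=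
  Classical.epsilon_spec (exists_isMaximalShooting β a b c)


/-! ### Sign and monotonicity lemmas for functions of one variable -/

theorem le_of_hasDerivAt_nonneg {g g' : ℝ → ℝ} {s t : ℝ} (hst : s ≤ t)
    (hc : ContinuousOn g (Icc s t)) (hd : ∀ x ∈ Ioo s t, HasDerivAt g (g' x) x)
    (h0 : ∀ x ∈ Ioo s t, 0 ≤ g' x) : g s ≤ g t := by
  rcases hst.eq_or_lt with rfl | hlt
  · exact le_rfl
  obtain ⟨x, hx, hx'⟩ := exists_hasDerivAt_eq_slope g g' hlt hc hd
  have h1 := h0 x hx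
  rw [hx'] at h1
  rw [le_div_iff₀ (sub_pos.2 hlt)] at h1
  linarith

theorem lt_of_hasDerivAt_pos {g g' : ℝ → ℝ} {s t : ℝ} (hlt : s < t)
    (hc : ContinuousOn g (Icc s t)) (hd : ∀ x ∈ Ioo s t, HasDerivAt g (g' x) x)
    (h0 : ∀ x ∈ Ioo s t, 0 < g' x) : g s < g t := by
  obtain ⟨x, hx, hx'⟩ := exists_hasDerivAt_eq_slope g g' hlt hc hd
  have h1 := h0 x hx
  rw [hx', div_pos_iff_of_pos_right (sub_pos.2 hlt)] at h1
  linarith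

/-- A continuous function that passes from negative to nonnegative values has a first zero. -/
theorem exists_first_zero {g : ℝ → ℝ} {s t : ℝ} (hst : s ≤ t) (hc : ContinuousOn g (Icc s t))
    (hs : g s < 0) (ht : 0 ≤ g t) : ∃ x ∈ Ioc s t, g x = 0 ∧ ∀ y ∈ Ico s x, g y < 0 := by
  have hK : IsCompact (Icc s t ∩ g ⁻¹' Ici 0) :=
    isCompact_Icc.of_isClosed_subset (hc.preimage_isClosed_of_isClosed isClosed_Icc isClosed_Ici)
      inter_subset_left
  obtain ⟨x, ⟨hx, hgx⟩, hmin⟩ := hK.exists_isLeast ⟨t, ⟨hst, le_rfl⟩, ht⟩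
  have hlt : ∀ y ∈ Ico s x, g y < 0 := by
    intro y hy
    by_contra hy'
    exact absurd (hmin ⟨⟨hy.1, hy.2.le.trans hx.2⟩, not_lt.1 hy'⟩) (not_le.2 hy.2)
  have hsx : s < x := by
    rcases hx.1.eq_or_lt with rfl | h
    · exact absurd hs (not_lt.2 hgx)
    · exact h
  refine ⟨x, ⟨hsx, hx.2⟩, le_antisymm ?_ hgx, hlt⟩
  by_contra hpos
  obtain ⟨y, hy, hy0⟩ := intermediate_value_Icc hx.1 (hc.mono (Icc_subset_Icc_right hx.2))
    (show (0 : ℝ) ∈ Icc (g s) (g x) from ⟨hs.le, hgx⟩)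
  rcases hy.2.eq_or_lt with rfl | h
  · exact hpos hy0.le
  · exact absurd (hlt y ⟨hy.1, h⟩) (by rw [hy0]; exact lt_irrefl _)

theorem hasDerivAt_nonneg_of_le_left {g : ℝ → ℝ} {g' s x : ℝ} (hsx : s < x)
    (hd : HasDerivAt g g' x) (h : ∀ y ∈ Ico s x, g y ≤ g x) : 0 ≤ g' := by
  have := (hasDerivAt_iff_tendsto_slope.1 hd).mono_left (nhdsLT_le_nhdsNE x)
  refine ge_of_tendsto this ?_
  filter_upwards [Ico_mem_nhdsLT hsx] with y hy
  rw [slope_def_field]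
  exact div_nonneg_of_nonpos (by linarith [h y hy]) (by linarith [hy.2])

theorem exists_lt_right_of_hasDerivAt_neg {g : ℝ → ℝ} {g' s t : ℝ} (hst : s < t)
    (hd : HasDerivAt g g' s) (hg' : g' < 0) : ∃ r ∈ Ioo s t, ∀ x ∈ Ioc s r, g x < g s := by
  have h1 := (hasDerivAt_iff_tendsto_slope.1 hd).mono_left (nhdsGT_le_nhdsNE s)
  obtain ⟨u, hu, hu'⟩ := mem_nhdsGT_iff_exists_Ioo_subset.1 (h1.eventually_lt_const hg')
  have hu0 : s < u := hu
  refine ⟨(s + min u t) / 2, ⟨by linarith [lt_min hu0 hst], by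
    linarith [lt_min hu0 hst, min_le_right u t]⟩, fun x hx => ?_⟩
  have h2 : slope g s x < 0 :=
    hu' ⟨hx.1, by linarith [hx.2, lt_min hu0 hst, min_le_left u t]⟩
  rw [slope_def_field, div_neg_iff] at h2
  rcases h2 with h2 | h2 <;> linarith [hx.1]

/-- A function that decreases through each of its zeros stays negative once it is nonpositive. -/
theorem neg_of_deriv_neg_at_zeros {g g' : ℝ → ℝ} {s t : ℝ}
    (hd : ∀ x ∈ Icc s t, HasDerivAt g (g' x) x) (hs : g s ≤ 0)
    (h0 : ∀ x ∈ Icc s t, g x = 0 → g' x < 0) : ∀ x ∈ Ioc s t, g x < 0 := by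
  intro x hx
  by_contra hgx
  obtain ⟨r, hr, hgr⟩ : ∃ r ∈ Ico s x, g r < 0 := by
    rcases hs.lt_or_eq with h | h
    · exact ⟨s, ⟨le_rfl, hx.1⟩, h⟩
    · have hs' : s ∈ Icc s t := ⟨le_rfl, hx.1.le.trans hx.2⟩
      obtain ⟨r, hr, hr'⟩ := exists_lt_right_of_hasDerivAt_neg hx.1 (hd s hs') (h0 s hs' h)
      exact ⟨r, ⟨hr.1.le, hr.2⟩, by linarith [hr' r ⟨hr.1, le_rfl⟩]⟩
  obtain ⟨y, hy, hy0, hylt⟩ := exists_first_zero hr.2.le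
    (fun z hz => (hd z ⟨hr.1.trans hz.1, hz.2.trans hx.2⟩).continuousAt.continuousWithinAt)
    hgr (not_lt.1 hgx)
  have hy' : y ∈ Icc s t := ⟨hr.1.trans hy.1.le, hy.2.trans hx.2⟩
  have := hasDerivAt_nonneg_of_le_left hy.1 (hd y hy') (fun z hz => by
    rw [hy0]; exact (hylt z hz).le)
  linarith [h0 y hy' hy0]

/-- A function that is eventually nonincreasing and bounded below converges. -/
theorem exists_tendsto_of_deriv_nonpos {g g' : ℝ → ℝ} {s m : ℝ}
    (hd : ∀ x, s ≤ x → HasDerivAt g (g' x) x) (h0 : ∀ x, s < x → g' x ≤ 0)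
    (hm : ∀ x, s ≤ x → m ≤ g x) :
    ∃ l, m ≤ l ∧ Tendsto g atTop (𝓝 l) ∧ ∀ x, s ≤ x → l ≤ g x := by
  have hanti : ∀ x y, s ≤ x → x ≤ y → g y ≤ g x := by
    intro x y hx hxy
    have := le_of_hasDerivAt_nonneg (g := fun z => -g z) (g' := fun z => -g' z) hxy
      (fun z hz => (hd z (hx.trans hz.1)).neg.continuousAt.continuousWithinAt)
      (fun z hz => (hd z (hx.trans hz.1.le)).neg)
      (fun z hz => by linarith [h0 z (hx.trans_lt hz.1)])
    simpa using this
  have hA : Antitone fun x => g (max s x) := fun x y hxy =>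
    hanti _ _ (le_max_left _ _) (max_le_max_left s hxy)
  have hB : BddBelow (range fun x => g (max s x)) := by
    refine ⟨m, ?_⟩
    rintro _ ⟨x, rfl⟩
    exact hm _ (le_max_left _ _)
  have hT := tendsto_atTop_ciInf hA hB
  refine ⟨⨅ x, g (max s x), le_ciInf fun x => hm _ (le_max_left _ _), hT.congr' ?_, ?_⟩
  · filter_upwards [eventually_ge_atTop s] with x hx
    rw [max_eq_right hx]
  · intro x hx
    have := ciInf_le hB x
    rwa [max_eq_right hx] at this

/-- A function with derivative bounded below by a positive constant tends to `+∞`. -/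
theorem tendsto_atTop_of_le_deriv {g g' : ℝ → ℝ} {s m : ℝ} (hm : 0 < m)
    (hd : ∀ x, s ≤ x → HasDerivAt g (g' x) x) (h0 : ∀ x, s ≤ x → m ≤ g' x) :
    Tendsto g atTop atTop := by
  have h1 : ∀ x, s ≤ x → g s + m * (x - s) ≤ g x := by
    intro x hx
    have := le_of_hasDerivAt_nonneg (g := fun z => g z - m * z) (g' := fun z => g' z - m * 1) hx
      (fun z hz => ((hd z hz.1).sub ((hasDerivAt_id z).const_mul m)).continuousAt.continuousWithinAt)
      (fun z hz => (hd z hz.1.le).sub ((hasDerivAt_id z).const_mul m))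
      (fun z hz => by linarith [h0 z hz.1.le])
    linarith
  refine tendsto_atTop_mono' _ (f₁ := fun x => g s + m * (x - s)) ?_ ?_
  · filter_upwards [eventually_ge_atTop s] with x hx using h1 x hx
  · exact tendsto_atTop_add_const_left _ _
      ((tendsto_atTop_add_const_right _ (-s) tendsto_id).const_mul_atTop hm)

/-! ### Phases of one trajectory -/

/-- The functions `f`, `p = f'`, `q = f''` of the shooting problem with `β ∈ (0, 1]`, `a ≥ 0` and
`b ≥ 1`, on the maximal interval `[0, T)`. Maximality enters only as unboundedness when `T < ∞`.
The functions are extended to negative times so that the derivatives at `0` are two-sided. -/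
structure IsMaxTraj (β a b c : ℝ) (f p q : ℝ → ℝ) (T : EReal) : Prop where
  β_pos : 0 < β
  β_le : β ≤ 1
  a_nonneg : 0 ≤ a
  one_le_b : 1 ≤ b
  T_pos : 0 < T
  f_zero : f 0 = a
  p_zero : p 0 = b
  q_zero : q 0 = c
  hf : ∀ t ∈ interval T, HasDerivAt f (p t) t
  hp : ∀ t ∈ interval T, HasDerivAt p (q t) t
  hq : ∀ t ∈ interval T, HasDerivAt q (-(f t * q t) - β * p t * (p t - 1)) t
  unbounded : T ≠ ⊤ → ∀ R : ℝ, ¬ ∀ t ∈ interval T, |f t| ≤ R ∧ |p t| ≤ R ∧ |q t| ≤ R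

namespace IsMaxTraj

variable {β a b c : ℝ} {f p q : ℝ → ℝ} {T : EReal}

theorem continuousOn_f (h : IsMaxTraj β a b c f p q T) {t : ℝ} (ht : t ∈ interval T) {s : ℝ}
    (hs : 0 ≤ s) : ContinuousOn f (Icc s t) := fun x hx =>
  (h.hf x (mem_interval_of_le ht (hs.trans hx.1) hx.2)).continuousAt.continuousWithinAt

theorem continuousOn_p (h : IsMaxTraj β a b c f p q T) {t : ℝ} (ht : t ∈ interval T) {s : ℝ}
    (hs : 0 ≤ s) : ContinuousOn p (Icc s t) := fun x hx =>
  (h.hp x (mem_interval_of_le ht (hs.trans hx.1) hx.2)).continuousAt.continuousWithinAt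

theorem continuousOn_q (h : IsMaxTraj β a b c f p q T) {t : ℝ} (ht : t ∈ interval T) {s : ℝ}
    (hs : 0 ≤ s) : ContinuousOn q (Icc s t) := fun x hx =>
  (h.hq x (mem_interval_of_le ht (hs.trans hx.1) hx.2)).continuousAt.continuousWithinAt

theorem zero_mem (h : IsMaxTraj β a b c f p q T) : (0 : ℝ) ∈ interval T :=
  zero_mem_interval h.T_pos

/-- `N = (p - σ)² + q²` measures the distance to the stationary state `p = σ`, `q = 0`, for
`σ ∈ {0, 1}`; it satisfies `|N'| ≤ K N`, hence vanishes identically or never. -/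
theorem exists_gronwall (h : IsMaxTraj β a b c f p q T) {σ : ℝ} (hσ : σ = 0 ∨ σ = 1) {t : ℝ}
    (ht : t ∈ interval T) : ∃ K : ℝ,
      (b - σ) ^ 2 + c ^ 2 ≤ ((p t - σ) ^ 2 + q t ^ 2) * Real.exp (K * t) ∧
      ((p t - σ) ^ 2 + q t ^ 2) * Real.exp (-K * t) ≤ (b - σ) ^ 2 + c ^ 2 := by
  obtain ⟨R₁, h1⟩ := (isCompact_Icc.image_of_continuousOn
    (h.continuousOn_f ht le_rfl)).isBounded.exists_norm_le
  obtain ⟨R₂, h2⟩ := (isCompact_Icc.image_of_continuousOn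
    (h.continuousOn_p ht le_rfl)).isBounded.exists_norm_le
  set K := 1 + 2 * R₁ + (R₂ + 1) with hK
  set N : ℝ → ℝ := fun x => (p x - σ) ^ 2 + q x ^ 2 with hN
  set N' : ℝ → ℝ := fun x => 2 * (p x - σ) * q x +
    2 * q x * (-(f x * q x) - β * p x * (p x - 1)) with hN'
  have hdN : ∀ x ∈ interval T, HasDerivAt N (N' x) x := by
    intro x hx
    have := (((h.hp x hx).sub_const σ).pow 2).add ((h.hq x hx).pow 2)
    refine this.congr_deriv ?_
    simp only [Nat.cast_ofNat, Nat.reduceSub, pow_one]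
    ring
  have hmem : ∀ x ∈ Icc 0 t, x ∈ interval T := fun x hx => mem_interval_of_le ht hx.1 hx.2
  have hbd : ∀ x ∈ Icc 0 t, |N' x| ≤ K * N x := by
    intro x hx
    have hf1 : |f x| ≤ R₁ := h1 _ ⟨x, hx, rfl⟩
    have hp1 : |p x| ≤ R₂ := h2 _ ⟨x, hx, rfl⟩
    have hβ0 := h.β_pos
    have hβ1 := h.β_le
    set u := p x - σ with hu
    -- this identity is where `σ ∈ {0, 1}` is needed
    have e1 : p x * (p x - 1) = u * (p x - 1 + σ) := by
      rcases hσ with rfl | rfl <;> simp only [hu] <;> ring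
    have e2 : N' x = 2 * u * q x - 2 * f x * q x ^ 2 - (2 * u * q x) * (β * (p x - 1 + σ)) := by
      simp only [hN']
      linear_combination (-2 * q x * β) * e1
    have b1 : |2 * u * q x| ≤ N x := by
      rw [abs_le]
      constructor <;> simp only [hN] <;> nlinarith [sq_nonneg (u + q x), sq_nonneg (u - q x)]
    have b2 : |β * (p x - 1 + σ)| ≤ R₂ + 1 := by
      rw [abs_mul, abs_of_pos hβ0]
      have : |p x - 1 + σ| ≤ R₂ + 1 := by
        obtain ⟨l1, l2⟩ := abs_le.1 hp1
        rw [abs_le]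
        rcases hσ with rfl | rfl <;> constructor <;> linarith
      calc β * |p x - 1 + σ| ≤ 1 * (R₂ + 1) := by gcongr
        _ = R₂ + 1 := one_mul _
    have b3 : |2 * f x * q x ^ 2| ≤ 2 * R₁ * N x := by
      rw [abs_mul, abs_mul, abs_of_nonneg (sq_nonneg (q x)), abs_two]
      have : q x ^ 2 ≤ N x := by simp only [hN]; nlinarith [sq_nonneg u]
      have hR1 : 0 ≤ R₁ := (abs_nonneg _).trans hf1
      gcongr
    have b4 : |(2 * u * q x) * (β * (p x - 1 + σ))| ≤ N x * (R₂ + 1) := by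
      rw [abs_mul]
      exact mul_le_mul b1 b2 (abs_nonneg _) ((abs_nonneg _).trans b1)
    rw [e2, hK]
    calc _ ≤ |2 * u * q x| + |2 * f x * q x ^ 2| + |(2 * u * q x) * (β * (p x - 1 + σ))| :=
          (abs_sub _ _).trans (add_le_add_left (abs_sub _ _) _)
      _ ≤ _ := by linarith
  have hexp : ∀ k x : ℝ, HasDerivAt (fun x => Real.exp (k * x)) (Real.exp (k * x) * k) x :=
    fun k x => by simpa using ((hasDerivAt_id x).const_mul k).exp
  have hN0 : N 0 = (b - σ) ^ 2 + c ^ 2 := by simp only [hN, h.p_zero, h.q_zero]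
  refine ⟨K, ?_, ?_⟩
  · have := le_of_hasDerivAt_nonneg (g := fun x => N x * Real.exp (K * x))
      (g' := fun x => N' x * Real.exp (K * x) + N x * (Real.exp (K * x) * K)) ht.1
      (fun x hx => ((hdN x (hmem x hx)).mul (hexp K x)).continuousAt.continuousWithinAt)
      (fun x hx => (hdN x (hmem x (Ioo_subset_Icc_self hx))).mul (hexp K x))
      (fun x hx => by
        have := (abs_le.1 (hbd x (Ioo_subset_Icc_self hx))).1
        have : 0 ≤ (N' x + K * N x) * Real.exp (K * x) :=
          mul_nonneg (by linarith) (Real.exp_pos _).le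
        linarith)
    simp only [mul_zero, Real.exp_zero, mul_one, hN0] at this
    exact this
  · have := le_of_hasDerivAt_nonneg (g := fun x => -(N x * Real.exp (-K * x)))
      (g' := fun x => -(N' x * Real.exp (-K * x) + N x * (Real.exp (-K * x) * -K))) ht.1
      (fun x hx => ((hdN x (hmem x hx)).mul (hexp (-K) x)).neg.continuousAt.continuousWithinAt)
      (fun x hx => ((hdN x (hmem x (Ioo_subset_Icc_self hx))).mul (hexp (-K) x)).neg)
      (fun x hx => by
        have := (abs_le.1 (hbd x (Ioo_subset_Icc_self hx))).2
        have : 0 ≤ (K * N x - N' x) * Real.exp (-K * x) :=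
          mul_nonneg (by linarith) (Real.exp_pos _).le
        linarith)
    simp only [mul_zero, Real.exp_zero, mul_one, hN0] at this
    linarith

/-- The stationary states `f' ≡ 0` and `f' ≡ 1` are not reached from another state. -/
theorem eq_of_stationary (h : IsMaxTraj β a b c f p q T) {σ : ℝ} (hσ : σ = 0 ∨ σ = 1) {t : ℝ}
    (ht : t ∈ interval T) (hpt : p t = σ) (hqt : q t = 0) : b = σ ∧ c = 0 := by
  obtain ⟨K, hK, -⟩ := h.exists_gronwall hσ ht
  rw [hpt, hqt] at hK
  simp only [sub_self, ne_eq, OfNat.ofNat_ne_zero, not_false_eq_true, zero_pow, add_zero,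
    zero_mul] at hK
  constructor
  · nlinarith [sq_nonneg (b - σ), sq_nonneg c]
  · nlinarith [sq_nonneg (b - σ), sq_nonneg c]

/-- For `b = 1` and `c = 0` the solution is `f t = a + t`. -/
theorem stationary (h : IsMaxTraj β a 1 0 f p q T) {t : ℝ} (ht : t ∈ interval T) :
    p t = 1 ∧ q t = 0 := by
  obtain ⟨K, -, hK⟩ := h.exists_gronwall (Or.inr rfl) ht
  have h0 : (p t - 1) ^ 2 + q t ^ 2 ≤ 0 := by
    by_contra hlt
    have := mul_pos (not_le.1 hlt) (Real.exp_pos (-K * t))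
    linarith
  constructor
  · nlinarith [sq_nonneg (p t - 1), sq_nonneg (q t)]
  · nlinarith [sq_nonneg (p t - 1), sq_nonneg (q t)]

theorem a_le_f (h : IsMaxTraj β a b c f p q T) {t : ℝ} (ht : t ∈ interval T)
    (hpos : ∀ x ∈ Ioo 0 t, 0 ≤ p x) : a ≤ f t := by
  have := le_of_hasDerivAt_nonneg ht.1 (h.continuousOn_f ht le_rfl)
    (fun x hx => h.hf x (mem_interval_of_le ht hx.1.le hx.2.le)) hpos
  rwa [h.f_zero] at this

/-- The energy `q² / 2 + β (p³ / 3 - p² / 2)` decreases as long as `f' ≥ 0`. -/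
theorem energy_le (h : IsMaxTraj β a b c f p q T) {s t : ℝ} (hs : 0 ≤ s) (hst : s ≤ t)
    (ht : t ∈ interval T) (hpos : ∀ x ∈ Ioo 0 t, 0 ≤ p x) :
    q t ^ 2 / 2 + β * (p t ^ 3 / 3 - p t ^ 2 / 2) ≤
      q s ^ 2 / 2 + β * (p s ^ 3 / 3 - p s ^ 2 / 2) := by
  have hd : ∀ x ∈ Icc s t, HasDerivAt
      (fun x => -(q x ^ 2 / 2 + β * (p x ^ 3 / 3 - p x ^ 2 / 2))) (f x * q x ^ 2) x := by
    intro x hx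
    have hx' := mem_interval_of_le ht (hs.trans hx.1) hx.2
    have := ((((h.hq x hx').pow 2).div_const 2).add
      (((((h.hp x hx').pow 3).div_const 3).sub (((h.hp x hx').pow 2).div_const 2)).const_mul β)).neg
    refine this.congr_deriv ?_
    simp only [Nat.cast_ofNat, Nat.reduceSub, pow_one]
    ring
  have := le_of_hasDerivAt_nonneg hst
    (fun x hx => (hd x hx).continuousAt.continuousWithinAt)
    (fun x hx => hd x (Ioo_subset_Icc_self hx))
    (fun x hx => mul_nonneg (h.a_nonneg.trans (h.a_le_f
      (mem_interval_of_le ht (hs.trans hx.1.le) hx.2.le)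
      fun y hy => hpos y ⟨hy.1, hy.2.trans hx.2⟩)) (sq_nonneg _))
  linarith

/-- While `f' > 0`, the decrease of the energy bounds `f'` and `f''`. -/
theorem exists_bound (h : IsMaxTraj β a b c f p q T) : ∃ P : ℝ, 0 ≤ P ∧
    ∀ t ∈ interval T, (∀ x ∈ Icc 0 t, 0 < p x) → p t ≤ P ∧ |q t| ≤ P := by
  have hβ := h.β_pos
  set E := c ^ 2 / 2 + β * (b ^ 3 / 3 - b ^ 2 / 2) with hE
  have hP : ∀ t ∈ interval T, (∀ x ∈ Icc 0 t, 0 < p x) → p t ≤ max 3 (E / β) := by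
    intro t ht hpos
    have h1 := h.energy_le le_rfl ht.1 ht (fun x hx => (hpos x (Ioo_subset_Icc_self hx)).le)
    rw [h.p_zero, h.q_zero, ← hE] at h1
    by_contra hlt
    rw [not_le, max_lt_iff] at hlt
    have h2 : p t ≤ p t ^ 3 / 3 - p t ^ 2 / 2 := by
      nlinarith [mul_pos (sub_pos.2 hlt.1) (sub_pos.2 hlt.1), sq_nonneg (p t),
        mul_nonneg (sq_nonneg (p t)) (sub_pos.2 hlt.1).le]
    have h3 : E < p t * β := (div_lt_iff₀ hβ).1 hlt.2
    nlinarith [sq_nonneg (q t)]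
  set P₁ := max 3 (E / β) with hP₁
  have hP₁0 : (3 : ℝ) ≤ P₁ := le_max_left _ _
  have hE2 : 0 ≤ 2 * |E| + β * P₁ ^ 2 := by positivity
  refine ⟨P₁ + (2 * |E| + β * P₁ ^ 2), by linarith, fun t ht hpos => ?_⟩
  have hp1 := hP t ht hpos
  have hp0 := hpos t ⟨ht.1, le_rfl⟩
  refine ⟨by linarith, ?_⟩
  have h1 := h.energy_le le_rfl ht.1 ht (fun x hx => (hpos x (Ioo_subset_Icc_self hx)).le)
  rw [h.p_zero, h.q_zero, ← hE] at h1
  have hq2 : q t ^ 2 ≤ 2 * |E| + β * P₁ ^ 2 := by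
    have h3 : 0 ≤ β * p t ^ 3 := by positivity
    have h4 : β * p t ^ 2 ≤ β * P₁ ^ 2 := by gcongr
    linarith [le_abs_self E]
  refine abs_le_of_sq_le_sq ?_ (by linarith)
  nlinarith

/-- If `f' > 0` on the whole interval of existence, then the solution is global. -/
theorem eq_top (h : IsMaxTraj β a b c f p q T) (hpos : ∀ t ∈ interval T, 0 < p t) : T = ⊤ := by
  by_contra hT
  obtain ⟨P, hP0, hP⟩ := h.exists_bound
  have hTb : T ≠ ⊥ := fun hb => absurd h.T_pos (by rw [hb]; simp)
  lift T to ℝ using ⟨hT, hTb⟩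
  have hT0 : 0 < T := by exact_mod_cast h.T_pos
  refine h.unbounded hT (a + P + P * T) fun t ht => ?_
  have hlt : ∀ x ∈ Icc 0 t, 0 < p x := fun x hx => hpos x (mem_interval_of_le ht hx.1 hx.2)
  obtain ⟨h1, h2⟩ := hP t ht hlt
  have h3 := h.a_le_f ht fun x hx => (hlt x (Ioo_subset_Icc_self hx)).le
  have ha := h.a_nonneg
  have htT : t ≤ T := by exact_mod_cast ht.2.le
  have h4 : f t ≤ a + P * t := by
    have := le_of_hasDerivAt_nonneg (g := fun x => P * x - f x) (g' := fun x => P * 1 - p x) ht.1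
      ((by fun_prop : Continuous fun x : ℝ => P * x).continuousOn.sub (h.continuousOn_f ht le_rfl))
      (fun x hx => ((hasDerivAt_id x).const_mul P).sub
        (h.hf x (mem_interval_of_le ht hx.1.le hx.2.le)))
      (fun x hx => by
        have := (hP x (mem_interval_of_le ht hx.1.le hx.2.le)
          fun y hy => hlt y ⟨hy.1, hy.2.trans hx.2.le⟩).1
        linarith)
    simp only [h.f_zero, mul_zero, zero_sub] at this
    linarith
  have h5 : P * t ≤ P * T := by gcongr
  have h6 : 0 ≤ P * T := by positivity
  have h7 := hpos t ht
  refine ⟨?_, ?_, h2.trans (by linarith)⟩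
  · rw [abs_of_nonneg (ha.trans h3)]; linarith
  · rw [abs_of_pos h7]; linarith

/-- The derivative of `φ = q + f (p - 1)` has the sign of `p (p - 1)`. -/
theorem hasDerivAt_phi (h : IsMaxTraj β a b c f p q T) {t : ℝ} (ht : t ∈ interval T) :
    HasDerivAt (fun x => q x + f x * (p x - 1)) ((1 - β) * p t * (p t - 1)) t := by
  have := (h.hq t ht).add ((h.hf t ht).mul ((h.hp t ht).sub_const 1))
  exact this.congr_deriv (by ring)

/-- After crossing the value `1` downwards, `f'` stays below `1` as long as it is positive. -/
theorem lt_one_of_crossing (h : IsMaxTraj β a b c f p q T) {s t : ℝ} (hs : 0 ≤ s)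
    (ht : t ∈ interval T) (hps : p s = 1) (hqs : q s < 0) (hpos : ∀ x ∈ Icc s t, 0 < p x) :
    ∀ x ∈ Ioc s t, p x < 1 := by
  intro x hx
  by_contra hpx
  have hmem : ∀ y ∈ Icc s t, y ∈ interval T := fun y hy =>
    mem_interval_of_le ht (hs.trans hy.1) hy.2
  have hsT : s ∈ interval T := hmem s ⟨le_rfl, hx.1.le.trans hx.2⟩
  obtain ⟨r, hr, hr'⟩ := exists_lt_right_of_hasDerivAt_neg hx.1 (h.hp s hsT) hqs
  obtain ⟨y, hy, hy0, hylt⟩ := exists_first_zero (g := fun z => p z - 1) hr.2.le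
    ((h.continuousOn_p (hmem x (Ioc_subset_Icc_self hx)) (hs.trans hr.1.le)).sub
      continuousOn_const)
    (by have := hr' r ⟨hr.1, le_rfl⟩; linarith) (by linarith [not_lt.1 hpx])
  have hyt : y ∈ Icc s t := ⟨hr.1.le.trans hy.1.le, hy.2.trans hx.2⟩
  have hlt : ∀ z ∈ Ioo s y, p z < 1 := by
    intro z hz
    rcases le_or_gt z r with hzr | hzr
    · linarith [hr' z ⟨hz.1, hzr⟩]
    · linarith [hylt z ⟨hzr.le, hz.2⟩]
  have hqy : 0 ≤ q y := by
    have := hasDerivAt_nonneg_of_le_left hy.1 ((h.hp y (hmem y hyt)).sub_const 1)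
      (fun z hz => by rw [hy0]; exact (hylt z hz).le)
    exact this
  have hφ := le_of_hasDerivAt_nonneg (g := fun z => -(q z + f z * (p z - 1)))
    (g' := fun z => -((1 - β) * p z * (p z - 1))) hyt.1
    (fun z hz => (h.hasDerivAt_phi
      (hmem z ⟨hz.1, hz.2.trans hyt.2⟩)).neg.continuousAt.continuousWithinAt)
    (fun z hz => (h.hasDerivAt_phi (hmem z ⟨hz.1.le, hz.2.le.trans hyt.2⟩)).neg)
    (fun z hz => by
      have h1 := hpos z ⟨hz.1.le, hz.2.le.trans hyt.2⟩
      have h2 := hlt z hz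
      have h3 := h.β_le
      have : 0 ≤ (1 - β) * p z * (1 - p z) := by
        have := sub_nonneg.2 h3
        have := (sub_pos.2 h2).le
        positivity
      linarith)
  simp only [hps, sub_self, mul_zero, add_zero, hy0] at hφ
  linarith

/-- For `c ≥ -a (b - 1)`, `f'` stays above `1`, unless `f t = a + t`. -/
theorem one_lt (h : IsMaxTraj β a b c f p q T) (hc : -a * (b - 1) ≤ c)
    (hne : ¬ (b = 1 ∧ c = 0)) {t : ℝ} (ht : t ∈ interval T) (ht0 : 0 < t) : 1 < p t := by
  obtain ⟨r, hr, hr'⟩ : ∃ r ∈ Ioo 0 t, ∀ x ∈ Ioc 0 r, 1 < p x := by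
    rcases h.one_le_b.eq_or_lt with rfl | hb
    · have hc0 : 0 < c := by
        rcases lt_trichotomy c 0 with h1 | h1 | h1
        · simp at hc; linarith
        · exact absurd ⟨rfl, h1⟩ hne
        · exact h1
      have hd := (h.hp 0 h.zero_mem).neg
      rw [h.q_zero] at hd
      obtain ⟨r, hr, hr'⟩ := exists_lt_right_of_hasDerivAt_neg ht0 hd (by linarith)
      refine ⟨r, hr, fun x hx => ?_⟩
      have := hr' x hx
      simp only [Pi.neg_apply, h.p_zero] at this
      linarith
    · have h1 : ∀ᶠ x in 𝓝 (0 : ℝ), 1 < p x :=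
        (h.hp 0 h.zero_mem).continuousAt.eventually_const_lt (by rw [h.p_zero]; exact hb)
      obtain ⟨ε, hε, hε'⟩ := Metric.eventually_nhds_iff.1 h1
      have hm : 0 < min ε t := lt_min hε ht0
      refine ⟨min ε t / 2, ⟨by linarith, by linarith [min_le_right ε t]⟩, fun x hx => hε' ?_⟩
      rw [Real.dist_eq, sub_zero, abs_of_pos hx.1]
      linarith [hx.2, min_le_left ε t]
  by_contra hpt
  obtain ⟨y, hy, hy0, hylt⟩ := exists_first_zero (g := fun z => 1 - p z) hr.2.le
    (continuousOn_const.sub (h.continuousOn_p ht hr.1.le))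
    (by have := hr' r ⟨hr.1, le_rfl⟩; linarith) (by linarith [not_lt.1 hpt])
  have hmem : ∀ z ∈ Icc 0 y, z ∈ interval T := fun z hz =>
    mem_interval_of_le ht hz.1 (hz.2.trans hy.2)
  have hy00 : 0 < y := hr.1.trans hy.1
  have hyT := hmem y ⟨hy00.le, le_rfl⟩
  have hgt : ∀ z ∈ Ioo 0 y, 1 < p z := by
    intro z hz
    rcases le_or_gt z r with hzr | hzr
    · exact hr' z ⟨hz.1, hzr⟩
    · linarith [hylt z ⟨hzr.le, hz.2⟩]
  have hqy : 0 ≤ -q y :=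
    hasDerivAt_nonneg_of_le_left hy.1 ((h.hp y hyT).const_sub 1)
      (fun z hz => by rw [hy0]; exact (hylt z hz).le)
  have hφ := le_of_hasDerivAt_nonneg hy00.le
    (fun z hz => (h.hasDerivAt_phi (hmem z hz)).continuousAt.continuousWithinAt)
    (fun z hz => h.hasDerivAt_phi (hmem z (Ioo_subset_Icc_self hz)))
    (fun z hz => by
      have h2 := hgt z hz
      have := sub_nonneg.2 h.β_le
      have := (sub_pos.2 h2).le
      have : 0 ≤ p z := by linarith
      positivity)
  have hpy : p y = 1 := by linarith
  simp only [hpy, h.q_zero, h.f_zero, h.p_zero, sub_self, mul_zero, add_zero] at hφ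
  exact hne (h.eq_of_stationary (Or.inr rfl) hyT hpy (by linarith))

/-- While `f' > 1`, a concave arc stays concave. -/
theorem q_neg_of_one_lt (h : IsMaxTraj β a b c f p q T) {s t : ℝ} (hs : 0 ≤ s)
    (ht : t ∈ interval T) (hqs : q s ≤ 0) (hp1 : ∀ x ∈ Icc s t, q x = 0 → 1 < p x) :
    ∀ x ∈ Ioc s t, q x < 0 := by
  refine neg_of_deriv_neg_at_zeros
    (fun x hx => h.hq x (mem_interval_of_le ht (hs.trans hx.1) hx.2)) hqs fun x hx hqx => ?_
  have h1 := hp1 x hx hqx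
  have : 0 < β * p x * (p x - 1) :=
    mul_pos (mul_pos h.β_pos (by linarith)) (by linarith)
  rw [hqx]
  linarith

/-- If `c < 0`, then `f''` can vanish only where `f' < 1`. -/
theorem lt_one_of_first_zero (h : IsMaxTraj β a b c f p q T) (hc : c < 0) {x : ℝ}
    (hx : x ∈ interval T) (hpx : 0 < p x) (hqx : q x = 0) (hneg : ∀ y ∈ Ico 0 x, q y < 0) :
    0 < x ∧ p x < 1 := by
  have hx0 : 0 < x := by
    rcases hx.1.eq_or_lt with rfl | h'
    · rw [h.q_zero] at hqx; linarith
    · exact h'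
  have h1 := hasDerivAt_nonneg_of_le_left hx0 (h.hq x hx) fun y hy => by
    rw [hqx]; exact (hneg y hy).le
  rw [hqx] at h1
  have h2 : p x ≤ 1 := by
    by_contra hlt
    have : 0 < β * p x * (p x - 1) := mul_pos (mul_pos h.β_pos hpx) (by linarith)
    linarith
  refine ⟨hx0, h2.lt_of_ne fun h3 => ?_⟩
  linarith [(h.eq_of_stationary (Or.inr rfl) hx h3 hqx).2]

/-- If `c < 0`, then after the first zero of `f''`, `f''` is positive and `f' < 1`, as long as
`f' > 0`. -/
theorem after_first_zero (h : IsMaxTraj β a b c f p q T) (hc : c < 0) {x t : ℝ}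
    (ht : t ∈ interval T) (hx : x ∈ Icc 0 t) (hpos : ∀ y ∈ Icc 0 t, 0 < p y) (hqx : q x = 0)
    (hneg : ∀ y ∈ Ico 0 x, q y < 0) : ∀ y ∈ Ioc x t, 0 < q y ∧ p y < 1 := by
  have hxT := mem_interval_of_le ht hx.1 hx.2
  obtain ⟨hx0, hpx⟩ := h.lt_one_of_first_zero hc hxT (hpos x hx) hqx hneg
  obtain ⟨r, hr, hpr⟩ := intermediate_value_Icc' hx.1 (h.continuousOn_p hxT le_rfl)
    (show (1 : ℝ) ∈ Icc (p x) (p 0) from ⟨hpx.le, by rw [h.p_zero]; exact h.one_le_b⟩)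
  have hrx : r < x := hr.2.lt_of_ne fun h' => by rw [h'] at hpr; linarith
  have hlt := h.lt_one_of_crossing hr.1 ht hpr (hneg r ⟨hr.1, hrx⟩)
    fun y hy => hpos y ⟨hr.1.trans hy.1, hy.2⟩
  have hq := neg_of_deriv_neg_at_zeros (g := fun y => -q y) (s := x) (t := t)
    (fun y hy => (h.hq y (mem_interval_of_le ht (hx.1.trans hy.1) hy.2)).neg) (by simp [hqx])
    (fun y hy hqy => by
      have h1 := hpos y ⟨hx.1.trans hy.1, hy.2⟩
      have h2 := hlt y ⟨hrx.trans_le hy.1, hy.2⟩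
      have h3 : 0 < β * p y * (1 - p y) := mul_pos (mul_pos h.β_pos h1) (by linarith)
      have h4 : q y = 0 := by linarith
      rw [h4]
      linarith)
  exact fun y hy => ⟨by linarith [hq y hy], hlt y ⟨hrx.trans hy.1, hy.2⟩⟩

/-- If `c < 0` and `f'` vanishes somewhere, then `f'' < 0` up to the first zero of `f'`. -/
theorem exists_hit_zero (h : IsMaxTraj β a b c f p q T) (hc : c < 0) {t : ℝ}
    (ht : t ∈ interval T) (hpt : p t ≤ 0) :
    ∃ s ∈ Icc 0 t, p s = 0 ∧ ∀ x ∈ Icc 0 s, q x < 0 := by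
  have hb := h.one_le_b
  obtain ⟨s, hs, hps, hlt⟩ := exists_first_zero (g := fun z => -p z) ht.1
    (h.continuousOn_p ht le_rfl).neg (by simp only [h.p_zero]; linarith) (by linarith)
  have hsT := mem_interval_of_le ht hs.1.le hs.2
  have hps0 : p s = 0 := by linarith
  have hqs : q s < 0 := by
    have h1 := hasDerivAt_nonneg_of_le_left hs.1 (h.hp s hsT).neg fun y hy => by
      simp only [Pi.neg_apply]; rw [hps]; exact (hlt y hy).le
    refine lt_of_le_of_ne (by linarith) fun h2 => ?_
    linarith [(h.eq_of_stationary (Or.inl rfl) hsT hps0 h2).1]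
  refine ⟨s, ⟨hs.1.le, hs.2⟩, hps0, fun x hx => ?_⟩
  by_contra hqx
  obtain ⟨y, hy, hqy, hyneg⟩ := exists_first_zero hx.1
    (h.continuousOn_q (mem_interval_of_le hsT hx.1 hx.2) le_rfl) (by rw [h.q_zero]; exact hc)
    (not_lt.1 hqx)
  have hys : y < s := (hy.2.trans hx.2).lt_of_ne fun h' => by rw [h'] at hqy; linarith
  have h1 := le_of_hasDerivAt_nonneg hys.le (h.continuousOn_p hsT hy.1.le)
    (fun z hz => h.hp z (mem_interval_of_le hsT (hy.1.le.trans hz.1.le) hz.2.le))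
    (fun z hz => (h.after_first_zero hc
      (mem_interval_of_le hsT (hy.1.le.trans hz.1.le) hz.2.le) ⟨hy.1.le, hz.1.le⟩
      (fun w hw => by linarith [hlt w ⟨hw.1, hw.2.trans_lt hz.2⟩]) hqy hyneg z
      ⟨hz.1, le_rfl⟩).1.le)
  linarith [hlt y ⟨hy.1.le, hys⟩]

/-- If `c < 0` and `f'` drops below `1`, then it reaches `1` first while `f'' < 0`. -/
theorem exists_hit_one (h : IsMaxTraj β a b c f p q T) (hc : c < 0) {t : ℝ}
    (ht : t ∈ interval T) (hpt : p t < 1) :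
    ∃ s ∈ Icc 0 t, p s = 1 ∧ ∀ x ∈ Icc 0 s, q x < 0 := by
  rcases h.one_le_b.eq_or_lt with hb | hb
  · refine ⟨0, ⟨le_rfl, ht.1⟩, by rw [h.p_zero, hb], fun x hx => ?_⟩
    rw [le_antisymm hx.2 hx.1, h.q_zero]
    exact hc
  obtain ⟨s, hs, hps, hlt⟩ := exists_first_zero (g := fun z => 1 - p z) ht.1
    (continuousOn_const.sub (h.continuousOn_p ht le_rfl)) (by simp only [h.p_zero]; linarith)
    (by linarith)
  have hsT := mem_interval_of_le ht hs.1.le hs.2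
  have hps1 : p s = 1 := by linarith
  refine ⟨s, ⟨hs.1.le, hs.2⟩, hps1, fun x hx => ?_⟩
  by_contra hqx
  have hxT := mem_interval_of_le hsT hx.1 hx.2
  obtain ⟨y, hy, hqy, hyneg⟩ := exists_first_zero hx.1 (h.continuousOn_q hxT le_rfl)
    (by rw [h.q_zero]; exact hc) (not_lt.1 hqx)
  have hpy : 1 ≤ p y := by
    rcases (hy.2.trans hx.2).eq_or_lt with h' | h'
    · rw [h', hps1]
    · linarith [hlt y ⟨hy.1.le, h'⟩]
  linarith [(h.lt_one_of_first_zero hc (mem_interval_of_le hxT hy.1.le hy.2) (by linarith) hqy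
    hyneg).2]

/-! ### Finite-time blow-up and limits at infinity -/

/-- If `f'` takes the value `0` while decreasing, then `f` is not global: `f'` and `f''` stay
negative, `f → -∞`, and then `w = -f'` satisfies `w'' ≥ β w²` with `w' > 0`, which forces
`w' ≥ k w ^ (3 / 2)`, so that `1 / √w` decreases linearly to a negative value. -/
theorem lt_top_of_hit_zero (h : IsMaxTraj β a b c f p q T) {s : ℝ} (hs : s ∈ interval T)
    (hps : p s = 0) (hqs : q s < 0) : T < ⊤ := by
  by_contra hT
  have hTop : T = ⊤ := not_lt_top_iff.1 hT
  have hmem : ∀ t, s ≤ t → t ∈ interval T := fun t ht => by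
    rw [hTop, interval_top]; exact hs.1.trans ht
  have hβ := h.β_pos
  have hq : ∀ t, s ≤ t → q t < 0 := by
    intro t ht
    by_contra hqt
    obtain ⟨y, hy, hqy, hneg⟩ := exists_first_zero ht (h.continuousOn_q (hmem t ht) hs.1) hqs
      (not_lt.1 hqt)
    have h1 := hasDerivAt_nonneg_of_le_left hy.1 (h.hq y (hmem y hy.1.le))
      (fun z hz => by rw [hqy]; exact (hneg z hz).le)
    have h2 := lt_of_hasDerivAt_pos (g := fun z => -p z) (g' := fun z => -q z) hy.1
      (h.continuousOn_p (hmem y hy.1.le) hs.1).neg (fun z hz => (h.hp z (hmem z hz.1.le)).neg)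
      (fun z hz => by linarith [hneg z ⟨hz.1.le, hz.2⟩])
    rw [hqy] at h1
    have h3 : p y < 0 := by linarith
    have : 0 < β * (-p y) * (1 - p y) := mul_pos (mul_pos hβ (by linarith)) (by linarith)
    linarith
  have hpanti : ∀ x y, s ≤ x → x ≤ y → p y ≤ p x := by
    intro x y hx hxy
    have := le_of_hasDerivAt_nonneg (g := fun z => -p z) (g' := fun z => -q z) hxy
      (h.continuousOn_p (hmem y (hx.trans hxy)) (hs.1.trans hx)).neg
      (fun z hz => (h.hp z (hmem z (hx.trans hz.1.le))).neg)
      (fun z hz => by linarith [hq z (hx.trans hz.1.le)])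
    linarith
  have hp1 : p (s + 1) < 0 := by
    have := lt_of_hasDerivAt_pos (g := fun z => -p z) (g' := fun z => -q z) (lt_add_one s)
      (h.continuousOn_p (hmem _ (by linarith)) hs.1).neg
      (fun z hz => (h.hp z (hmem z hz.1.le)).neg)
      (fun z hz => by linarith [hq z hz.1.le])
    linarith
  have hfT : Tendsto (fun t => -f t) atTop atTop :=
    tendsto_atTop_of_le_deriv (s := s + 1) (m := -p (s + 1)) (by linarith)
      (fun x hx => (h.hf x (hmem x (by linarith))).neg)
      (fun x hx => by linarith [hpanti (s + 1) x (by linarith) hx])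
  obtain ⟨u, hu⟩ := eventually_atTop.1 (hfT.eventually_ge_atTop 0)
  set r := max u (s + 1) with hr
  have hrs : s + 1 ≤ r := le_max_right _ _
  have hrm : ∀ t, r ≤ t → s ≤ t := fun t ht => by linarith
  -- beyond `r`, `f ≤ 0`, so that `q' ≤ -β p ^ 2`
  have hq' : ∀ t, r ≤ t → -(f t * q t) - β * p t * (p t - 1) ≤ -β * p t ^ 2 := by
    intro t ht
    have h1 : 0 ≤ -f t := hu t ((le_max_left _ _).trans ht)
    have h2 := hq t (hrm t ht)
    have h3 : p t < 0 := by linarith [hpanti (s + 1) t (by linarith) (hrs.trans ht)]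
    nlinarith [mul_nonneg h1 (neg_pos.2 h2).le, mul_pos hβ (neg_pos.2 h3)]
  have hqr : ∀ t, r ≤ t → q t ≤ q r := by
    intro t ht
    have := le_of_hasDerivAt_nonneg (g := fun z => -q z)
      (g' := fun z => -(-(f z * q z) - β * p z * (p z - 1))) ht
      (h.continuousOn_q (hmem t (hrm t ht)) (hs.1.trans (hrm r le_rfl))).neg
      (fun z hz => (h.hq z (hmem z (hrm z hz.1.le))).neg)
      (fun z hz => by
        have := hq' z hz.1.le
        have : 0 ≤ β * p z ^ 2 := by positivity
        linarith)
    linarith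
  have hpT : Tendsto (fun t => -p t) atTop atTop :=
    tendsto_atTop_of_le_deriv (s := r) (m := -q r) (by linarith [hq r (hrm r le_rfl)])
      (fun x hx => (h.hp x (hmem x (hrm x hx))).neg) (fun x hx => by linarith [hqr x hx])
  -- multiplying `q' ≤ -β p ^ 2` by `q < 0` and integrating
  set H : ℝ → ℝ := fun t => q t ^ 2 / 2 + β * p t ^ 3 / 3 with hH
  have hHmono : ∀ t, r ≤ t → H r ≤ H t := by
    intro t ht
    have hd : ∀ x ∈ Icc r t, HasDerivAt H
        (q x * (-(f x * q x) - β * p x * (p x - 1) + β * p x ^ 2)) x := by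
      intro x hx
      have hx' := hmem x (hrm x hx.1)
      have := (((h.hq x hx').pow 2).div_const 2).add
        ((((h.hp x hx').pow 3).const_mul β).div_const 3)
      refine this.congr_deriv ?_
      simp only [Nat.cast_ofNat, Nat.reduceSub, pow_one]
      ring
    refine le_of_hasDerivAt_nonneg ht (fun x hx => (hd x hx).continuousAt.continuousWithinAt)
      (fun x hx => hd x (Ioo_subset_Icc_self hx)) fun x hx => ?_
    have h1 := hq' x hx.1.le
    exact mul_nonneg_of_nonpos_of_nonpos (hq x (hrm x hx.1.le)).le (by linarith)
  obtain ⟨v, hv⟩ := eventually_atTop.1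
    (hpT.eventually_ge_atTop (max 1 (6 * |H r| / β)))
  set m := max v r with hm
  have hmr : r ≤ m := le_max_right _ _
  have hw1 : ∀ t, m ≤ t → 1 ≤ -p t := fun t ht =>
    (le_max_left _ _).trans (hv t ((le_max_left _ _).trans ht))
  have hq2 : ∀ t, m ≤ t → β / 3 * (-p t) ^ 3 ≤ q t ^ 2 := by
    intro t ht
    have h1 := hHmono t (hmr.trans ht)
    have h2 := hw1 t ht
    have h3 : 6 * |H r| / β ≤ -p t :=
      (le_max_right _ _).trans (hv t ((le_max_left _ _).trans ht))
    rw [div_le_iff₀ hβ] at h3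
    have h4 : -p t ≤ (-p t) ^ 3 := le_self_pow₀ h2 (by norm_num)
    have h5 : -p t * β ≤ (-p t) ^ 3 * β := by gcongr
    have h6 : H t = q t ^ 2 / 2 - β * (-p t) ^ 3 / 3 := by simp only [hH]; ring
    have h7 := neg_abs_le (H r)
    linarith
  set k := √(β / 3) / 2 with hk
  have hk0 : 0 < k := by positivity
  have hd : ∀ t, m ≤ t → HasDerivAt (fun x => -(√(-p x))⁻¹)
      (-(-(-q t / (2 * √(-p t))) / √(-p t) ^ 2)) t := by
    intro t ht
    have h1 := hw1 t ht
    have h2 := (h.hp t (hmem t (hrm t (hmr.trans ht)))).neg.sqrt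
      (by simp only [Pi.neg_apply]; linarith)
    exact (h2.fun_inv (by simp only [Pi.neg_apply]; positivity)).neg
  have hbig : Tendsto (fun t => -(√(-p t))⁻¹) atTop atTop := by
    refine tendsto_atTop_of_le_deriv (s := m) hk0 hd fun t ht => ?_
    have h1 := hw1 t ht
    have hw0 : 0 < -p t := by linarith
    have hsq : √(-p t) ^ 2 = -p t := Real.sq_sqrt hw0.le
    have hs0 : 0 < √(-p t) := Real.sqrt_pos.2 hw0
    have hz : √(β / 3) * (-p t * √(-p t)) ≤ -q t := by
      refine le_of_sq_le_sq ?_ (by linarith [hq t (hrm t (hmr.trans ht))])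
      rw [mul_pow, mul_pow, hsq, Real.sq_sqrt (by positivity)]
      calc β / 3 * ((-p t) ^ 2 * -p t) = β / 3 * (-p t) ^ 3 := by ring
        _ ≤ q t ^ 2 := hq2 t ht
        _ = (-q t) ^ 2 := by ring
    have e : -(-(-q t / (2 * √(-p t))) / √(-p t) ^ 2) = -q t / (2 * (-p t * √(-p t))) := by
      rw [hsq]
      field_simp
    rw [e, le_div_iff₀ (by positivity), hk]
    linarith
  obtain ⟨y, hy⟩ := eventually_atTop.1 (hbig.eventually_gt_atTop 0)
  have h1 := hy (max y m) (le_max_left _ _)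
  have h2 : 0 ≤ (√(-p (max y m)))⁻¹ := by positivity
  linarith

/-- If `f → +∞`, the only possible limit of `f'` is `1`. Were the limit `l ≠ 1`, one could choose
`κ` close to `(1 - β) l + β` so that `χ = q + f (p - κ)` is monotone while `p - κ` keeps a
definite sign; then `f''` would have a nonzero (infinite) limit. -/
theorem limit_eq_one (h : IsMaxTraj β a b c f p q ⊤) (hpos : ∀ t, 0 ≤ t → 0 < p t) {l : ℝ}
    (hl : Tendsto p atTop (𝓝 l)) (hf : Tendsto f atTop atTop) : l = 1 := by
  have hβ := h.β_pos
  have hβ1 := h.β_le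
  have hmem : ∀ t : ℝ, 0 ≤ t → t ∈ interval ⊤ := fun t ht => by rw [interval_top]; exact ht
  have hχ : ∀ κ t, 0 ≤ t → HasDerivAt (fun x => q x + f x * (p x - κ))
      (p t * ((1 - β) * p t + β - κ)) t := by
    intro κ t ht
    have := (h.hq t (hmem t ht)).add ((h.hf t (hmem t ht)).mul ((h.hp t (hmem t ht)).sub_const κ))
    exact this.congr_deriv (by ring)
  have hl0 : 0 ≤ l := ge_of_tendsto hl (by
    filter_upwards [eventually_ge_atTop 0] with t ht using (hpos t ht).le)
  rcases lt_trichotomy l 1 with hlt | heq | hgt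
  · exfalso
    set ε := β * (1 - l) / 3 with hε
    have hε0 : 0 < ε := by have := sub_pos.2 hlt; positivity
    have hnear : ∀ᶠ t in atTop, l - ε < p t ∧ p t < l + ε :=
      (hl.eventually_const_lt (by linarith)).and (hl.eventually_lt_const (by linarith))
    obtain ⟨s, hs⟩ := eventually_atTop.1 (hnear.and ((hf.eventually_ge_atTop 0).and
      (eventually_ge_atTop 0)))
    set κ := (1 - β) * l + β - ε with hκ
    have hs0 : 0 ≤ s := (hs s le_rfl).2.2
    have hχm : ∀ t, s ≤ t → q s + f s * (p s - κ) ≤ q t + f t * (p t - κ) := by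
      intro t ht
      refine le_of_hasDerivAt_nonneg ht
        (fun x hx => (hχ κ x (hs0.trans hx.1)).continuousAt.continuousWithinAt)
        (fun x hx => hχ κ x (hs0.trans hx.1.le)) fun x hx => ?_
      have h1 := (hs x hx.1.le).1.1
      have h2 : (1 - β) * (l - ε) ≤ (1 - β) * p x :=
        mul_le_mul_of_nonneg_left h1.le (sub_nonneg.2 hβ1)
      have h3 : 0 ≤ β * ε := by positivity
      exact mul_nonneg (hpos x (hs0.trans hx.1.le)).le (by linarith)
    have hqT : Tendsto q atTop atTop := by
      refine tendsto_atTop_mono' _ (f₁ := fun t => (q s + f s * (p s - κ)) + ε * f t) ?_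
        (tendsto_atTop_add_const_left _ _ (hf.const_mul_atTop hε0))
      filter_upwards [eventually_ge_atTop s] with t ht
      have h1 := hχm t ht
      obtain ⟨⟨-, h2⟩, h3, -⟩ := hs t ht
      have h4 : p t - κ ≤ -ε := by rw [hκ]; linarith
      nlinarith
    obtain ⟨r, hr⟩ := eventually_atTop.1 (hqT.eventually_ge_atTop 1)
    have := tendsto_atTop_of_le_deriv (g := p) (g' := q) (s := max r 0) one_pos
      (fun x hx => h.hp x (hmem x ((le_max_right _ _).trans hx)))
      (fun x hx => hr x ((le_max_left _ _).trans hx))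
    exact not_tendsto_nhds_of_tendsto_atTop this l hl
  · exact heq
  · exfalso
    set ε := β * (l - 1) / 3 with hε
    have hε0 : 0 < ε := by have := sub_pos.2 hgt; positivity
    have hnear : ∀ᶠ t in atTop, l - ε < p t ∧ p t < l + ε :=
      (hl.eventually_const_lt (by linarith)).and (hl.eventually_lt_const (by linarith))
    obtain ⟨s, hs⟩ := eventually_atTop.1 (hnear.and ((hf.eventually_ge_atTop 0).and
      (eventually_ge_atTop 0)))
    set κ := (1 - β) * l + β + ε with hκ
    have hs0 : 0 ≤ s := (hs s le_rfl).2.2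
    have hχm : ∀ t, s ≤ t → q t + f t * (p t - κ) ≤ q s + f s * (p s - κ) := by
      intro t ht
      have := le_of_hasDerivAt_nonneg (g := fun x => -(q x + f x * (p x - κ)))
        (g' := fun t => -(p t * ((1 - β) * p t + β - κ))) ht
        (fun x hx => (hχ κ x (hs0.trans hx.1)).neg.continuousAt.continuousWithinAt)
        (fun x hx => (hχ κ x (hs0.trans hx.1.le)).neg) fun x hx => by
          have h1 := (hs x hx.1.le).1.2
          have h2 : (1 - β) * p x ≤ (1 - β) * (l + ε) :=
            mul_le_mul_of_nonneg_left h1.le (sub_nonneg.2 hβ1)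
          have h3 : 0 ≤ β * ε := by positivity
          have := mul_nonneg (hpos x (hs0.trans hx.1.le)).le
            (show 0 ≤ -((1 - β) * p x + β - κ) by linarith)
          linarith
      linarith
    have hqT : Tendsto (fun t => -q t) atTop atTop := by
      refine tendsto_atTop_mono' _ (f₁ := fun t => -(q s + f s * (p s - κ)) + ε * f t) ?_
        (tendsto_atTop_add_const_left _ _ (hf.const_mul_atTop hε0))
      filter_upwards [eventually_ge_atTop s] with t ht
      have h1 := hχm t ht
      obtain ⟨⟨h2, -⟩, h3, -⟩ := hs t ht
      have h4 : ε ≤ p t - κ := by rw [hκ]; linarith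
      nlinarith
    obtain ⟨r, hr⟩ := eventually_atTop.1 (hqT.eventually_ge_atTop 1)
    have := tendsto_atTop_of_le_deriv (g := fun x => -p x) (g' := fun x => -q x) (s := max r 0)
      one_pos (fun x hx => (h.hp x (hmem x ((le_max_right _ _).trans hx))).neg)
      (fun x hx => hr x ((le_max_left _ _).trans hx))
    exact not_tendsto_nhds_of_tendsto_atTop this (-l) hl.neg

/-- If `f'` has a positive limit, this limit is `1`. -/
theorem limit_eq_one_of_pos (h : IsMaxTraj β a b c f p q ⊤) (hpos : ∀ t, 0 ≤ t → 0 < p t) {l : ℝ}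
    (hl : Tendsto p atTop (𝓝 l)) (hl0 : 0 < l) : l = 1 := by
  obtain ⟨s, hs⟩ := eventually_atTop.1 ((hl.eventually_const_lt (half_lt_self hl0)).and
    (eventually_ge_atTop (0 : ℝ)))
  exact h.limit_eq_one hpos hl (tendsto_atTop_of_le_deriv (s := s) (half_pos hl0)
    (fun x hx => h.hf x (by rw [interval_top]; exact (hs x hx).2)) fun x hx => (hs x hx).1.le)

/-! ### The three kinds of solutions -/

/-- Solutions with `f' > 0` everywhere and `f' → 1`. -/
def IsRegular (p : ℝ → ℝ) (T : EReal) : Prop :=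
  T = ⊤ ∧ (∀ t, 0 ≤ t → 0 < p t) ∧ Tendsto p atTop (𝓝 1)

/-- Bounded concave solutions with `f' > 0`, `f'' < 0`, `f' → 0` and `f'' → 0`. -/
def IsCritical (f p q : ℝ → ℝ) (T : EReal) : Prop :=
  T = ⊤ ∧ (∀ t, 0 ≤ t → 0 < p t ∧ q t < 0) ∧ Tendsto p atTop (𝓝 0) ∧ Tendsto q atTop (𝓝 0) ∧
    ∃ B, ∀ t, 0 ≤ t → f t ≤ B

/-- Solutions for which `f'` vanishes, with `f'' < 0` up to the first zero of `f'`. -/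
def IsBlowUp (p q : ℝ → ℝ) (T : EReal) : Prop :=
  T < ⊤ ∧ ∃ s ∈ interval T, p s = 0 ∧ ∀ x ∈ Icc 0 s, q x < 0

/-- A global solution with `f' > 0` and `f'' < 0` is regular with `f' > 1`, or critical: `f'` has a
limit, and if this limit is `0` then `f` is bounded, by `limit_eq_one`. -/
theorem regular_or_critical_of_q_neg (h : IsMaxTraj β a b c f p q T) (hT : T = ⊤)
    (hpos : ∀ t, 0 ≤ t → 0 < p t) (hq : ∀ t, 0 < t → q t < 0) :
    IsRegular p T ∧ (∀ t, 0 < t → 1 < p t) ∨ (c < 0 → IsCritical f p q T) := by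
  subst hT
  have hmem : ∀ t : ℝ, 0 ≤ t → t ∈ interval ⊤ := fun t ht => by rw [interval_top]; exact ht
  obtain ⟨l, hl0, hl, hle⟩ := exists_tendsto_of_deriv_nonpos (s := 0)
    (fun x hx => h.hp x (hmem x hx)) (fun x hx => (hq x hx).le) (fun x hx => (hpos x hx).le)
  rcases hl0.eq_or_lt with rfl | hl0
  · refine Or.inr fun hc => ⟨rfl, fun t ht => ⟨hpos t ht, ?_⟩, hl, ?_, ?_⟩
    · rcases ht.eq_or_lt with rfl | h'
      · rw [h.q_zero]; exact hc
      · exact hq t h'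
    · -- once `f' < 1`, `f''` is increasing, so it converges, and its limit cannot be negative
      obtain ⟨s, hs⟩ := eventually_atTop.1 ((hl.eventually_lt_const one_pos).and
        (eventually_gt_atTop (0 : ℝ)))
      have hs0 := (hs s le_rfl).2
      obtain ⟨m, hm0, hm, hmle⟩ := exists_tendsto_of_deriv_nonpos (g := fun t => -q t) (s := s)
        (m := 0) (fun x hx => (h.hq x (hmem x (hs0.le.trans hx))).neg) (fun x hx => by
          obtain ⟨h1, h2⟩ := hs x hx.le
          have h3 := hpos x h2.le
          have h4 : 0 ≤ f x := h.a_nonneg.trans (h.a_le_f (hmem x h2.le)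
            fun y hy => (hpos y hy.1.le).le)
          have h5 := hq x h2
          have h6 : 0 ≤ β * p x * (1 - p x) :=
            mul_nonneg (mul_nonneg h.β_pos.le h3.le) (by linarith)
          have h7 : 0 ≤ f x * -q x := mul_nonneg h4 (by linarith)
          linarith) (fun x hx => by linarith [hq x (hs0.trans_le hx)])
      rcases hm0.eq_or_lt with rfl | hm0
      · simpa using hm.neg
      · have := tendsto_atTop_of_le_deriv (g := fun x => -p x) (g' := fun x => -q x) (s := s) hm0
          (fun x hx => (h.hp x (hmem x (hs0.le.trans hx))).neg) hmle
        exact absurd hl.neg (not_tendsto_nhds_of_tendsto_atTop this _)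
    · by_contra hB
      push Not at hB
      have hfT : Tendsto f atTop atTop := by
        refine tendsto_atTop.2 fun B => ?_
        obtain ⟨s, hs, hBs⟩ := hB B
        filter_upwards [eventually_ge_atTop s] with t ht
        refine hBs.le.trans (le_of_hasDerivAt_nonneg ht
          (h.continuousOn_f (hmem t (hs.trans ht)) hs)
          (fun x hx => h.hf x (hmem x (hs.trans hx.1.le)))
          fun x hx => (hpos x (hs.trans hx.1.le)).le)
      exact zero_ne_one (h.limit_eq_one hpos hl hfT)
  · have h1 := h.limit_eq_one_of_pos hpos hl hl0
    subst h1
    refine Or.inl ⟨⟨rfl, hpos, hl⟩, fun t ht => ?_⟩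
    have := lt_of_hasDerivAt_pos (g := fun z => -p z) (g' := fun z => -q z) (lt_add_one t)
      (h.continuousOn_p (hmem _ (by linarith)) ht.le).neg
      (fun z hz => (h.hp z (hmem z (ht.le.trans hz.1.le))).neg)
      (fun z hz => by linarith [hq z (ht.trans hz.1)])
    linarith [hle (t + 1) (by linarith)]

/-- Shape of the solutions with `c ≥ -a (b - 1)` other than `f t = a + t`: `f' > 1` and `f' → 1`;
such a solution is concave if `c ≤ 0` and convex-concave if `c > 0`. -/
theorem regular_of_ge (h : IsMaxTraj β a b c f p q T) (hc : -a * (b - 1) ≤ c)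
    (hne : ¬ (b = 1 ∧ c = 0)) : IsRegular p T ∧ (c ≤ 0 → ∀ t, 0 < t → q t < 0) ∧
      (0 < c → ∃ s, 0 < s ∧ (∀ t ∈ Ico 0 s, 0 < q t) ∧ ∀ t, s < t → q t < 0) := by
  have hb := h.one_le_b
  have hge : ∀ t ∈ interval T, 0 < p t := by
    intro t ht
    rcases ht.1.eq_or_lt with rfl | h0
    · rw [h.p_zero]; linarith
    · linarith [h.one_lt hc hne ht h0]
  have hT := h.eq_top hge
  subst hT
  have hmem : ∀ t : ℝ, 0 ≤ t → t ∈ interval ⊤ := fun t ht => by rw [interval_top]; exact ht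
  have hpos : ∀ t, 0 ≤ t → 0 < p t := fun t ht => hge t (hmem t ht)
  have hone : ∀ t, 0 < t → 1 < p t := fun t ht => h.one_lt hc hne (hmem t ht.le) ht
  have hq_neg : ∀ s, 0 ≤ s → (0 < s ∨ c < 0 ∨ 1 < b) → q s ≤ 0 → ∀ t, s < t → q t < 0 := by
    intro s hs hs' hqs t hst
    refine h.q_neg_of_one_lt hs (hmem t (hs.trans hst.le)) hqs (fun x hx hqx => ?_) t ⟨hst, le_rfl⟩
    rcases (hs.trans hx.1).eq_or_lt with h0 | h0
    · rw [← h0] at hqx ⊢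
      rcases hs' with h1 | h1 | h1
      · linarith [hx.1]
      · rw [h.q_zero] at hqx; linarith
      · rwa [h.p_zero]
    · exact hone x h0
  have hlim : ∀ s, 0 ≤ s → (∀ t, s < t → q t < 0) → Tendsto p atTop (𝓝 1) := by
    intro s hs hqs
    obtain ⟨l, hl1, hl, -⟩ := exists_tendsto_of_deriv_nonpos (s := s) (m := 1)
      (fun x hx => h.hp x (hmem x (hs.trans hx))) (fun x hx => (hqs x hx).le) (fun x hx => by
        rcases (hs.trans hx).eq_or_lt with h0 | h0
        · rw [← h0, h.p_zero]; exact hb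
        · exact (hone x h0).le)
    rwa [h.limit_eq_one_of_pos hpos hl (by linarith)] at hl
  rcases le_or_gt c 0 with hc0 | hc0
  · have hq : ∀ t, 0 < t → q t < 0 := by
      refine hq_neg 0 le_rfl ?_ (by rw [h.q_zero]; exact hc0)
      rcases hb.eq_or_lt with h1 | h1
      · exact Or.inr (Or.inl (hc0.lt_of_ne fun h2 => hne ⟨h1.symm, h2⟩))
      · exact Or.inr (Or.inr h1)
    exact ⟨⟨rfl, hpos, hlim 0 le_rfl hq⟩, fun _ => hq, fun h' => absurd h' (not_lt.2 hc0)⟩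
  · obtain ⟨r, hr, hqr⟩ : ∃ r, 0 ≤ r ∧ q r ≤ 0 := by
      by_contra hcon
      push Not at hcon
      obtain ⟨P, hP0, hP⟩ := h.exists_bound
      obtain ⟨l, -, hl, hle⟩ := exists_tendsto_of_deriv_nonpos (g := fun t => -p t) (s := 0)
        (m := -P) (fun x hx => (h.hp x (hmem x hx)).neg)
        (fun x hx => by linarith [hcon x hx.le])
        (fun x hx => by linarith [(hP x (hmem x hx) fun y hy => hpos y hy.1).1])
      have h1 := hone 1 one_pos
      have h2 := hle 1 zero_le_one
      have h3 : Tendsto p atTop (𝓝 (-l)) := by simpa using hl.neg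
      have := h.limit_eq_one_of_pos hpos h3 (by linarith)
      linarith
    obtain ⟨s, hs, hqs, hlt⟩ := exists_first_zero (g := fun t => -q t) hr
      (h.continuousOn_q (hmem r hr) le_rfl).neg (by simp only [h.q_zero]; linarith) (by linarith)
    have hqs' := hq_neg s hs.1.le (Or.inl hs.1) (by linarith)
    exact ⟨⟨rfl, hpos, hlim s hs.1.le hqs'⟩, fun h' => absurd h' (not_le.2 hc0), fun _ =>
      ⟨s, hs.1, fun t ht => by linarith [hlt t ht], hqs'⟩⟩

/-- Classification for `c < 0`: the solution blows up, or is critical, or is regular, and in the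
last case it is concave with `f' > 1` or concave-convex. -/
theorem classification (h : IsMaxTraj β a b c f p q T) (hc : c < 0) :
    IsBlowUp p q T ∨ IsCritical f p q T ∨ (IsRegular p T ∧
      ((∀ t, 0 ≤ t → q t < 0) ∧ (∀ t, 0 < t → 1 < p t) ∨
        ∃ x, 0 < x ∧ p x < 1 ∧ (∀ t ∈ Ico 0 x, q t < 0) ∧ q x = 0 ∧ ∀ t, x < t → 0 < q t)) := by
  by_cases hhit : ∃ t ∈ interval T, p t ≤ 0
  · obtain ⟨t, ht, hpt⟩ := hhit
    obtain ⟨s, hs, hps, hqs⟩ := h.exists_hit_zero hc ht hpt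
    have hsT := mem_interval_of_le ht hs.1 hs.2
    exact Or.inl ⟨h.lt_top_of_hit_zero hsT hps (hqs s ⟨hs.1, le_rfl⟩), s, hsT, hps, hqs⟩
  push Not at hhit
  have hT := h.eq_top hhit
  subst hT
  have hmem : ∀ t : ℝ, 0 ≤ t → t ∈ interval ⊤ := fun t ht => by rw [interval_top]; exact ht
  have hpos : ∀ t, 0 ≤ t → 0 < p t := fun t ht => hhit t (hmem t ht)
  right
  by_cases hq : ∀ t, 0 ≤ t → q t < 0
  · rcases h.regular_or_critical_of_q_neg rfl hpos (fun t ht => hq t ht.le) with h1 | h1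
    · exact Or.inr ⟨h1.1, Or.inl ⟨hq, h1.2⟩⟩
    · exact Or.inl (h1 hc)
  · push Not at hq
    obtain ⟨r, hr, hqr⟩ := hq
    obtain ⟨x, hx, hqx, hneg⟩ := exists_first_zero hr (h.continuousOn_q (hmem r hr) le_rfl)
      (by rw [h.q_zero]; exact hc) hqr
    have hafter : ∀ t, x < t → 0 < q t ∧ p t < 1 := fun t ht =>
      h.after_first_zero hc (hmem t (hx.1.le.trans ht.le)) ⟨hx.1.le, ht.le⟩
        (fun y hy => hpos y hy.1) hqx hneg t ⟨ht, le_rfl⟩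
    have hpx := (h.lt_one_of_first_zero hc (hmem x hx.1.le) (hpos x hx.1.le) hqx hneg).2
    obtain ⟨l, -, hl, hle⟩ := exists_tendsto_of_deriv_nonpos (g := fun t => -p t) (s := x)
      (m := -1) (fun t ht => (h.hp t (hmem t (hx.1.le.trans ht))).neg)
      (fun t ht => by linarith [(hafter t ht).1])
      (fun t ht => by
        rcases ht.eq_or_lt with rfl | h'
        · linarith
        · linarith [(hafter t h').2])
    have h3 : Tendsto p atTop (𝓝 (-l)) := by simpa using hl.neg
    have h4 := h.limit_eq_one_of_pos hpos h3 (by linarith [hle x le_rfl, hpos x hx.1.le])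
    rw [h4] at h3
    exact Or.inr ⟨⟨rfl, hpos, h3⟩, Or.inr ⟨x, hx.1, hpx, hneg, hqx, fun t ht => (hafter t ht).1⟩⟩

end IsMaxTraj

/-! ### Comparison of two trajectories at equal values of `f'` -/

/-- The inverse of a function with negative derivative on a compact interval. -/
theorem exists_inverse_of_deriv_neg {p q : ℝ → ℝ} {t δ : ℝ} (ht : 0 ≤ t) (hδ : 0 < δ)
    (hp : ∀ x ∈ Icc 0 t, HasDerivAt p (q x) x) (hq : ∀ x ∈ Icc 0 t, q x ≤ -δ) :
    ∃ σ : ℝ → ℝ, ContinuousOn σ (Icc (p t) (p 0)) ∧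
      (∀ y ∈ Icc (p t) (p 0), σ y ∈ Icc 0 t ∧ p (σ y) = y) ∧ σ (p 0) = 0 ∧ σ (p t) = t ∧
      ∀ y ∈ Ioo (p t) (p 0), HasDerivAt σ (q (σ y))⁻¹ y := by
  have hc : ContinuousOn p (Icc 0 t) := fun x hx => (hp x hx).continuousAt.continuousWithinAt
  have hle : ∀ x ∈ Icc 0 t, ∀ y ∈ Icc 0 t, x ≤ y → δ * (y - x) ≤ p x - p y := by
    intro x hx y hy hxy
    have := le_of_hasDerivAt_nonneg (g := fun z => -p z - δ * z) (g' := fun z => -q z - δ * 1) hxy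
      (fun z hz => ((hp z ⟨hx.1.trans hz.1, hz.2.trans hy.2⟩).neg.sub
        ((hasDerivAt_id z).const_mul δ)).continuousAt.continuousWithinAt)
      (fun z hz => (hp z ⟨hx.1.trans hz.1.le, hz.2.le.trans hy.2⟩).neg.sub
        ((hasDerivAt_id z).const_mul δ))
      (fun z hz => by linarith [hq z ⟨hx.1.trans hz.1.le, hz.2.le.trans hy.2⟩])
    linarith
  have hinj : InjOn p (Icc 0 t) := by
    intro x hx y hy hxy
    rcases le_total x y with h | h
    · have := hle x hx y hy h
      nlinarith
    · have := hle y hy x hx h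
      nlinarith
  have hsurj : ∀ y ∈ Icc (p t) (p 0), ∃ x ∈ Icc 0 t, p x = y := fun y hy =>
    intermediate_value_Icc' ht hc hy
  choose! σ hσ hσp using hsurj
  have h0 : (0 : ℝ) ∈ Icc 0 t := ⟨le_rfl, ht⟩
  have htt : t ∈ Icc 0 t := ⟨ht, le_rfl⟩
  have hpt : p t ≤ p 0 := by
    have := hle 0 h0 t htt ht
    nlinarith
  have hcont : ContinuousOn σ (Icc (p t) (p 0)) := by
    refine (LipschitzOnWith.of_dist_le_mul (K := (δ⁻¹).toNNReal) fun y hy z hz => ?_).continuousOn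
    rw [Real.coe_toNNReal _ (by positivity), inv_mul_eq_div, le_div_iff₀ hδ, Real.dist_eq,
      Real.dist_eq]
    have e1 := hσp y hy
    have e2 := hσp z hz
    rcases le_total (σ y) (σ z) with h | h
    · have := hle _ (hσ y hy) _ (hσ z hz) h
      rw [abs_of_nonpos (by linarith)]
      linarith [le_abs_self (y - z)]
    · have := hle _ (hσ z hz) _ (hσ y hy) h
      rw [abs_of_nonneg (by linarith)]
      linarith [neg_abs_le (y - z)]
  refine ⟨σ, hcont, fun y hy => ⟨hσ y hy, hσp y hy⟩, ?_, ?_, fun y hy => ?_⟩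
  · exact hinj (hσ _ ⟨hpt, le_rfl⟩) h0 (hσp _ ⟨hpt, le_rfl⟩)
  · exact hinj (hσ _ ⟨le_rfl, hpt⟩) htt (hσp _ ⟨le_rfl, hpt⟩)
  · have hy' := Ioo_subset_Icc_self hy
    refine HasDerivAt.of_local_left_inverse (hcont.continuousAt (Icc_mem_nhds hy.1 hy.2))
      (hp _ (hσ y hy')) (by linarith [hq _ (hσ y hy')]) ?_
    filter_upwards [Icc_mem_nhds hy.1 hy.2] with z hz using hσp z hz

namespace IsMaxTraj

variable {β a b c₁ c₂ : ℝ} {f₁ p₁ q₁ f₂ p₂ q₂ : ℝ → ℝ} {T₁ T₂ : EReal}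

/-- The derivative of `q + f p`. -/
theorem hasDerivAt_q_add_mul (h : IsMaxTraj β a b c₁ f₁ p₁ q₁ T₁) {t : ℝ} (ht : t ∈ interval T₁) :
    HasDerivAt (fun x => q₁ x + f₁ x * p₁ x) (p₁ t * ((1 - β) * p₁ t + β)) t := by
  have := (h.hq t ht).add ((h.hf t ht).mul (h.hp t ht))
  exact this.congr_deriv (by ring)

/-- Comparison principle: if `c₁ < c₂` and the second solution is strictly concave until `f'`
reaches some level `≥ 0`, then the first solution reaches the same level, and is there strictly
concave with smaller `f''`. With both solutions parametrized by the value `y` of `f'`, the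
differences `f₂ - f₁` and `f₂'' - f₁''` satisfy a cooperative differential system as `y`
decreases, so they stay nonnegative. -/
theorem comparison (h₁ : IsMaxTraj β a b c₁ f₁ p₁ q₁ T₁) (h₂ : IsMaxTraj β a b c₂ f₂ p₂ q₂ T₂)
    (hc : c₁ < c₂) {t₂ : ℝ} (ht₂ : t₂ ∈ interval T₂) (hq₂ : ∀ x ∈ Icc 0 t₂, q₂ x < 0)
    (hp₂ : 0 ≤ p₂ t₂) :
    ∃ t₁ ∈ interval T₁, p₁ t₁ = p₂ t₂ ∧ (∀ x ∈ Icc 0 t₁, q₁ x < 0) ∧ q₁ t₁ < q₂ t₂ ∧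
      c₂ - c₁ ≤ (q₂ t₂ + f₂ t₂ * p₂ t₂) - (q₁ t₁ + f₁ t₁ * p₁ t₁) := by
  have hc₂ : c₂ < 0 := by
    have := hq₂ 0 ⟨le_rfl, ht₂.1⟩
    rwa [h₂.q_zero] at this
  rcases ht₂.1.eq_or_lt with rfl | ht₂0
  · refine ⟨0, h₁.zero_mem, by rw [h₁.p_zero, h₂.p_zero], fun x hx => ?_, ?_, ?_⟩
    · rw [le_antisymm hx.2 hx.1, h₁.q_zero]; linarith
    · rw [h₁.q_zero, h₂.q_zero]; exact hc
    · rw [h₁.q_zero, h₂.q_zero, h₁.f_zero, h₂.f_zero, h₁.p_zero, h₂.p_zero]; linarith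
  have hmem₂ : ∀ x ∈ Icc 0 t₂, x ∈ interval T₂ := fun x hx => mem_interval_of_le ht₂ hx.1 hx.2
  have hb := h₂.one_le_b
  have hβ := h₂.β_pos
  obtain ⟨δ, hδ, hδq⟩ : ∃ δ > 0, ∀ x ∈ Icc 0 t₂, q₂ x ≤ -δ := by
    obtain ⟨m, hm, hmax⟩ := isCompact_Icc.exists_isMaxOn ⟨0, le_rfl, ht₂.1⟩
      (h₂.continuousOn_q ht₂ le_rfl)
    exact ⟨-q₂ m, by linarith [hq₂ m hm], fun x hx => by simpa using hmax hx⟩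
  obtain ⟨σ, hσc, hσ, hσ0, hσt, hσd⟩ := exists_inverse_of_deriv_neg ht₂.1 hδ
    (fun x hx => h₂.hp x (hmem₂ x hx)) hδq
  rw [h₂.p_zero] at hσc hσ hσ0 hσd
  set y₀ := p₂ t₂ with hy₀
  have hy₀b : y₀ < b := by
    have := lt_of_hasDerivAt_pos (g := fun z => -p₂ z) (g' := fun z => -q₂ z) ht₂0
      (h₂.continuousOn_p ht₂ le_rfl).neg
      (fun z hz => (h₂.hp z (hmem₂ z (Ioo_subset_Icc_self hz))).neg)
      (fun z hz => by linarith [hq₂ z (Ioo_subset_Icc_self hz)])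
    rw [h₂.p_zero] at this
    linarith
  -- `τ s` is the time at which the second solution has the slope of the first one at time `s`;
  -- slopes above `b` (which do not occur) are cut off
  set τ : ℝ → ℝ := fun s => σ (min b (p₁ s)) with hτ
  have hτ0 : τ 0 = 0 := by simp only [hτ, h₁.p_zero, min_self, hσ0]
  have hmin : ∀ s, y₀ ≤ p₁ s → min b (p₁ s) ∈ Icc y₀ b := fun s hs =>
    ⟨le_min hy₀b.le hs, min_le_left _ _⟩
  set D : ℝ → ℝ := fun s => q₂ (τ s) - q₁ s with hD
  have hD0 : D 0 = c₂ - c₁ := by simp only [hD, hτ0, h₁.q_zero, h₂.q_zero]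
  have hτc : ∀ t ∈ interval T₁, (∀ s ∈ Icc 0 t, y₀ ≤ p₁ s) →
      ContinuousOn τ (Icc 0 t) ∧ MapsTo τ (Icc 0 t) (Icc 0 t₂) := by
    intro t ht hge
    refine ⟨hσc.comp ((continuousOn_const (c := b)).inf (h₁.continuousOn_p ht le_rfl))
      fun s hs => hmin s (hge s hs), fun s hs => (hσ _ (hmin s (hge s hs))).1⟩
  have hDc : ∀ t ∈ interval T₁, (∀ s ∈ Icc 0 t, y₀ ≤ p₁ s) → ContinuousOn D (Icc 0 t) := by
    intro t ht hge
    obtain ⟨h3, h4⟩ := hτc t ht hge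
    exact ((h₂.continuousOn_q ht₂ le_rfl).comp h3 h4).sub (h₁.continuousOn_q ht le_rfl)
  have key : ∀ x ∈ interval T₁, (∀ s ∈ Icc 0 x, y₀ ≤ p₁ s) → (∀ s ∈ Ico 0 x, 0 < D s) →
      ∀ s ∈ Ioo 0 x, HasDerivAt τ (q₁ s / q₂ (τ s)) s ∧ p₂ (τ s) = p₁ s ∧ τ s ∈ Icc 0 t₂ ∧
        q₁ s < q₂ (τ s) ∧ 1 ≤ q₁ s / q₂ (τ s) ∧ p₁ s ∈ Ioo y₀ b := by
    intro x hx hge hDpos s hs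
    have hq₁ : ∀ r ∈ Ico 0 x, q₁ r < 0 := fun r hr => by
      have h3 := hDpos r hr
      have h4 := hq₂ _ ((hτc x hx hge).2 (Ico_subset_Icc_self hr))
      simp only [hD] at h3
      linarith
    have hanti : ∀ r₁ r₂, 0 ≤ r₁ → r₁ < r₂ → r₂ ≤ x → p₁ r₂ < p₁ r₁ := by
      intro r₁ r₂ hr₁ hr hr₂
      have := lt_of_hasDerivAt_pos (g := fun z => -p₁ z) (g' := fun z => -q₁ z) hr
        (h₁.continuousOn_p (mem_interval_of_le hx (hr₁.trans hr.le) hr₂) hr₁).neg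
        (fun z hz => (h₁.hp z
          (mem_interval_of_le hx (hr₁.trans hz.1.le) (hz.2.le.trans hr₂))).neg)
        (fun z hz => by linarith [hq₁ z ⟨hr₁.trans hz.1.le, hz.2.trans_le hr₂⟩])
      linarith
    have hsb : p₁ s < b := by
      have := hanti 0 s le_rfl hs.1 hs.2.le
      rwa [h₁.p_zero] at this
    have hsy : y₀ < p₁ s :=
      (hge x ⟨hs.1.le.trans hs.2.le, le_rfl⟩).trans_lt (hanti s x hs.1.le hs.2 le_rfl)
    have hτs : τ s = σ (p₁ s) := by simp only [hτ, min_eq_right hsb.le]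
    have hτmem := (hτc x hx hge).2 (Ioo_subset_Icc_self hs)
    have hDs := hDpos s ⟨hs.1.le, hs.2⟩
    have hlt : q₁ s < q₂ (τ s) := by simp only [hD] at hDs; linarith
    have hdp := h₁.hp s (mem_interval_of_le hx hs.1.le hs.2.le)
    refine ⟨?_, ?_, hτmem, hlt, ?_, hsy, hsb⟩
    · have h3 := (hσd (p₁ s) ⟨hsy, hsb⟩).comp s hdp
      rw [← hτs, inv_mul_eq_div] at h3
      refine h3.congr_of_eventuallyEq ?_
      filter_upwards [hdp.continuousAt.eventually_lt_const hsb] with r hr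
      simp only [hτ, min_eq_right hr.le, Function.comp]
    · rw [hτs]
      exact (hσ _ ⟨hsy.le, hsb.le⟩).2
    · rw [one_le_div_of_neg (hq₂ _ hτmem)]
      exact hlt.le
  have claim : ∀ t ∈ interval T₁, (∀ s ∈ Icc 0 t, y₀ ≤ p₁ s) → ∀ s ∈ Icc 0 t, 0 < D s := by
    intro t ht hge s hs
    by_contra hDs
    obtain ⟨x, hx, hDx, hlt⟩ := exists_first_zero (g := fun r => -D r) hs.1
      ((hDc t ht hge).mono (Icc_subset_Icc_right hs.2)).neg (by simp only [hD0]; linarith)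
      (by linarith)
    have hxt : x ≤ t := hx.2.trans hs.2
    have hxT := mem_interval_of_le ht hx.1.le hxt
    have hge' : ∀ s ∈ Icc 0 x, y₀ ≤ p₁ s := fun r hr => hge r ⟨hr.1, hr.2.trans hxt⟩
    have hDpos : ∀ s ∈ Ico 0 x, 0 < D s := fun r hr => by linarith [hlt r hr]
    have hkey := key x hxT hge' hDpos
    have hmem₁ : ∀ r ∈ Icc 0 x, r ∈ interval T₁ := fun r hr => mem_interval_of_le hxT hr.1 hr.2
    -- `f₂ ∘ τ - f₁` starts at `0`, and its derivative `p₁ (q₁ / (q₂ ∘ τ) - 1)` is nonnegative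
    have hX : ∀ r ∈ Ioo 0 x, 0 ≤ f₂ (τ r) - f₁ r := by
      intro r hr
      have hrx : Icc 0 r ⊆ Icc 0 x := Icc_subset_Icc_right hr.2.le
      obtain ⟨h3, h4⟩ := hτc x hxT hge'
      have := le_of_hasDerivAt_nonneg (g := fun z => f₂ (τ z) - f₁ z)
        (g' := fun z => p₂ (τ z) * (q₁ z / q₂ (τ z)) - p₁ z) hr.1.le
        ((((h₂.continuousOn_f ht₂ le_rfl).comp h3 h4).mono hrx).sub
          (h₁.continuousOn_f (hmem₁ r (Ioo_subset_Icc_self hr)) le_rfl))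
        (fun z hz => by
          have hz' : z ∈ Ioo 0 x := ⟨hz.1, hz.2.trans hr.2⟩
          obtain ⟨k1, k2, k3, -, -⟩ := hkey z hz'
          exact ((h₂.hf _ (hmem₂ _ k3)).comp z k1).sub (h₁.hf z (hmem₁ z (Ioo_subset_Icc_self hz'))))
        (fun z hz => by
          obtain ⟨-, k2, -, -, k5, k6⟩ := hkey z ⟨hz.1, hz.2.trans hr.2⟩
          rw [k2]
          have hp0 : 0 ≤ p₁ z := hp₂.trans k6.1.le
          have := mul_le_mul_of_nonneg_left k5 hp0
          linarith)
      simpa [hτ0, h₁.f_zero, h₂.f_zero] using this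
    -- `D' ≥ -K D`, so `D * exp (K r)` does not decrease, and `D` cannot reach `0`
    set K := β * b ^ 2 / δ with hK
    have hexp : ∀ r : ℝ, HasDerivAt (fun x => Real.exp (K * x)) (Real.exp (K * r) * K) r :=
      fun r => by simpa using ((hasDerivAt_id r).const_mul K).exp
    have := le_of_hasDerivAt_nonneg (g := fun r => D r * Real.exp (K * r))
      (g' := fun r => ((-(f₂ (τ r) * q₂ (τ r)) - β * p₂ (τ r) * (p₂ (τ r) - 1)) *
        (q₁ r / q₂ (τ r)) - (-(f₁ r * q₁ r) - β * p₁ r * (p₁ r - 1))) * Real.exp (K * r) +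
        D r * (Real.exp (K * r) * K)) hx.1.le
      ((hDc x hxT hge').mul (by fun_prop))
      (fun r hr => by
        obtain ⟨k1, -, k3, -, -⟩ := hkey r hr
        exact (((h₂.hq _ (hmem₂ _ k3)).comp r k1).sub
          (h₁.hq r (hmem₁ r (Ioo_subset_Icc_self hr)))).mul (hexp r))
      (fun r hr => by
        obtain ⟨-, k2, k3, k4, -, k6⟩ := hkey r hr
        have hX' := hX r hr
        have hq2 := hδq _ k3
        have hDr := hDpos r ⟨hr.1.le, hr.2⟩
        rw [k2]
        set Q := q₂ (τ r) with hQ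
        have hQ0 : Q < 0 := by linarith
        have e : (-(f₂ (τ r) * Q) - β * p₁ r * (p₁ r - 1)) * (q₁ r / Q) -
            (-(f₁ r * q₁ r) - β * p₁ r * (p₁ r - 1)) =
            -q₁ r * (f₂ (τ r) - f₁ r) + β * p₁ r * (p₁ r - 1) / Q * D r := by
          simp only [hD]
          rw [← hQ]
          field_simp [hQ0.ne]
          ring
        have hp0 : 0 ≤ p₁ r := hp₂.trans k6.1.le
        have hpp : p₁ r * (p₁ r - 1) ≤ b ^ 2 := by nlinarith [k6.2]
        -- `δ ≤ -Q` gives `β p (p - 1) / Q ≥ -K`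
        have hKQ : 0 ≤ β * p₁ r * (p₁ r - 1) / Q + K := by
          have h3 : β * p₁ r * (p₁ r - 1) / (-Q) ≤ K := by
            rw [hK, div_le_div_iff₀ (by linarith) hδ]
            have h4 : β * (p₁ r * (p₁ r - 1)) * δ ≤ β * b ^ 2 * δ := by gcongr
            have h5 : β * b ^ 2 * δ ≤ β * b ^ 2 * -Q :=
              mul_le_mul_of_nonneg_left (by linarith) (by positivity)
            linarith
          rw [div_neg] at h3
          linarith
        rw [e]
        have h6 : 0 ≤ -q₁ r * (f₂ (τ r) - f₁ r) := mul_nonneg (by linarith) hX'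
        have h7 := mul_nonneg hKQ hDr.le
        have h8 := mul_nonneg (add_nonneg h6 h7) (Real.exp_pos (K * r)).le
        linarith)
    have hDx0 : D x = 0 := by linarith
    simp only [hD0, hDx0, mul_zero, Real.exp_zero, mul_one, zero_mul] at this
    linarith
  have hq₁ : ∀ t ∈ interval T₁, (∀ s ∈ Icc 0 t, y₀ ≤ p₁ s) → ∀ s ∈ Icc 0 t, q₁ s ≤ -δ := by
    intro t ht hge s hs
    have h3 := claim t ht hge s hs
    have h4 := hδq _ ((hτc t ht hge).2 hs)
    simp only [hD] at h3
    linarith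
  obtain ⟨t, ht, hpt⟩ : ∃ t ∈ interval T₁, p₁ t ≤ y₀ := by
    by_contra hcon
    push Not at hcon
    have hT := h₁.eq_top fun t ht => hp₂.trans_lt (hcon t ht)
    have hmem : ∀ t : ℝ, 0 ≤ t → t ∈ interval T₁ := fun t ht => by
      rw [hT, interval_top]; exact ht
    have h3 := tendsto_atTop_of_le_deriv (g := fun x => -p₁ x) (g' := fun x => -q₁ x) (s := 0) hδ
      (fun x hx => (h₁.hp x (hmem x hx)).neg)
      (fun x hx => by
        have := hq₁ x (hmem x hx) (fun s hs => (hcon s (hmem s hs.1)).le) x ⟨hx, le_rfl⟩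
        linarith)
    obtain ⟨x, hx, hx0⟩ := ((h3.eventually_ge_atTop (-y₀)).and (eventually_ge_atTop 0)).exists
    linarith [hcon x (hmem x hx0)]
  obtain ⟨t₁, ht₁, hpt₁, hlt⟩ := exists_first_zero (g := fun z => y₀ - p₁ z) ht.1
    (continuousOn_const.sub (h₁.continuousOn_p ht le_rfl)) (by simp only [h₁.p_zero]; linarith)
    (by linarith)
  have ht₁T := mem_interval_of_le ht ht₁.1.le ht₁.2
  have hp₁y : p₁ t₁ = y₀ := by linarith
  have hge : ∀ s ∈ Icc 0 t₁, y₀ ≤ p₁ s := by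
    intro s hs
    rcases hs.2.eq_or_lt with rfl | h'
    · exact hp₁y.ge
    · linarith [hlt s ⟨hs.1, h'⟩]
  have hcl := claim t₁ ht₁T hge
  have hτt : τ t₁ = t₂ := by simp only [hτ, hp₁y, min_eq_right hy₀b.le, hσt]
  refine ⟨t₁, ht₁T, hp₁y, fun x hx => by linarith [hq₁ t₁ ht₁T hge x hx], ?_, ?_⟩
  · have := hcl t₁ ⟨ht₁.1.le, le_rfl⟩
    simp only [hD, hτt] at this
    linarith
  · have hkey := key t₁ ht₁T hge fun s hs => hcl s (Ico_subset_Icc_self hs)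
    obtain ⟨h3, h4⟩ := hτc t₁ ht₁T hge
    have := le_of_hasDerivAt_nonneg
      (g := fun z => (q₂ (τ z) + f₂ (τ z) * p₂ (τ z)) - (q₁ z + f₁ z * p₁ z))
      (g' := fun z => p₂ (τ z) * ((1 - β) * p₂ (τ z) + β) * (q₁ z / q₂ (τ z)) -
        p₁ z * ((1 - β) * p₁ z + β)) ht₁.1.le
      ((((h₂.continuousOn_q ht₂ le_rfl).add ((h₂.continuousOn_f ht₂ le_rfl).mul
        (h₂.continuousOn_p ht₂ le_rfl))).comp h3 h4).sub
        ((h₁.continuousOn_q ht₁T le_rfl).add ((h₁.continuousOn_f ht₁T le_rfl).mul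
        (h₁.continuousOn_p ht₁T le_rfl))))
      (fun z hz => by
        obtain ⟨k1, -, k3, -, -⟩ := hkey z hz
        exact ((h₂.hasDerivAt_q_add_mul (hmem₂ _ k3)).comp z k1).sub
          (h₁.hasDerivAt_q_add_mul (mem_interval_of_le ht₁T hz.1.le hz.2.le)))
      (fun z hz => by
        obtain ⟨-, k2, -, -, k5, k6⟩ := hkey z hz
        rw [k2]
        have hp0 : 0 ≤ p₁ z := hp₂.trans k6.1.le
        have h1β := sub_nonneg.2 h₂.β_le
        have := mul_le_mul_of_nonneg_left k5
          (show 0 ≤ p₁ z * ((1 - β) * p₁ z + β) by positivity)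
        linarith)
    simp only [hτ0, hτt, h₁.q_zero, h₂.q_zero, h₁.f_zero, h₂.f_zero, h₁.p_zero,
      h₂.p_zero] at this
    linarith

end IsMaxTraj

/-! ### The family of shooting solutions -/

/-- Replacement of a function on negative times by an affine function of slope `v`. -/
noncomputable def extendLeft (g : ℝ → ℝ) (v t : ℝ) : ℝ := if t < 0 then g 0 + v * t else g t

theorem extendLeft_of_nonneg {g : ℝ → ℝ} {v t : ℝ} (ht : 0 ≤ t) : extendLeft g v t = g t :=
  if_neg (not_lt.2 ht)

theorem hasDerivAt_extendLeft {g : ℝ → ℝ} {v w t : ℝ} (ht : 0 ≤ t)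
    (hd : HasDerivWithinAt g w (Ici 0) t) (hv : t = 0 → v = w) :
    HasDerivAt (extendLeft g v) w t := by
  have h1 : HasDerivWithinAt (extendLeft g v) w (Ici 0) t :=
    hd.congr (fun x hx => extendLeft_of_nonneg hx) (extendLeft_of_nonneg ht)
  rcases ht.eq_or_lt with rfl | h0
  · have h2 : HasDerivWithinAt (extendLeft g v) w (Iic 0) 0 := by
      have h3 : HasDerivAt (fun x => g 0 + v * x) w 0 := by
        simpa [hv rfl] using ((hasDerivAt_id (0 : ℝ)).const_mul v).const_add (g 0)
      refine h3.hasDerivWithinAt.congr (fun x hx => ?_) (by simp [extendLeft])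
      rcases (show x ≤ 0 from hx).eq_or_lt with rfl | hx0
      · simp [extendLeft]
      · exact if_pos hx0
    rw [← hasDerivWithinAt_univ, ← Iic_union_Ici (a := (0 : ℝ))]
    exact h2.union h1
  · exact h1.hasDerivAt (Ici_mem_nhds h0)

/-- The shooting solutions with their first two derivatives, as maximal trajectories depending
continuously on `c`. -/
theorem exists_family {β a b : ℝ} (hβ : β ∈ Ioc (0 : ℝ) 1) (ha : 0 ≤ a) (hb : 1 ≤ b) :
    ∃ f p q : ℝ → ℝ → ℝ, (∀ c, IsMaxTraj β a b c (f c) (p c) (q c) (lifespan β a b c)) ∧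
      (∀ c, EqOn (shoot β a b c) (f c) (interval (lifespan β a b c))) ∧
      ∀ c, ∀ t ∈ interval (lifespan β a b c), ∀ ε > 0, ∀ᶠ c' in 𝓝 c,
        t ∈ interval (lifespan β a b c') ∧
          ∀ s ∈ Icc 0 t, |p c' s - p c s| < ε ∧ |q c' s - q c s| < ε := by
  have hmax := isMaximalShooting_shoot β a b
  choose X hX hX0 hXf using fun c => (hmax c).1.exists_isFlow
  have hT : ∀ c, 0 < lifespan β a b c := fun c => (hmax c).1.1
  have hlong : ∀ c (Y : ℝ → ℝ × ℝ × ℝ) (S : EReal), 0 < S → IsFlow β Y S → Y 0 = (a, b, c) →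
      S ≤ lifespan β a b c := fun c Y S hS hY hY0 =>
    ((hmax c).2 _ S (hY.isShootingOn hS hY0 fun _ _ => rfl)).1
  let f : ℝ → ℝ → ℝ := fun c => extendLeft (fun t => (X c t).1) b
  let p : ℝ → ℝ → ℝ := fun c => extendLeft (fun t => (X c t).2.1) c
  let q : ℝ → ℝ → ℝ := fun c => extendLeft (fun t => (X c t).2.2) (-(a * c) - β * b * (b - 1))
  have hf : ∀ c t, 0 ≤ t → f c t = (X c t).1 := fun c t ht => extendLeft_of_nonneg ht
  have hp : ∀ c t, 0 ≤ t → p c t = (X c t).2.1 := fun c t ht => extendLeft_of_nonneg ht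
  have hq : ∀ c t, 0 ≤ t → q c t = (X c t).2.2 := fun c t ht => extendLeft_of_nonneg ht
  refine ⟨f, p, q, fun c => ?_, fun c t ht => ?_, fun c t ht ε hε => ?_⟩
  · refine
      { β_pos := hβ.1, β_le := hβ.2, a_nonneg := ha, one_le_b := hb, T_pos := hT c
        f_zero := by rw [hf c 0 le_rfl, hX0]
        p_zero := by rw [hp c 0 le_rfl, hX0]
        q_zero := by rw [hq c 0 le_rfl, hX0]
        hf := fun t ht => ?_, hp := fun t ht => ?_, hq := fun t ht => ?_, unbounded := ?_ }
    · rw [hp c t ht.1]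
      exact hasDerivAt_extendLeft ht.1 ((hX c).components ht).1 fun h0 => by rw [h0, hX0]
    · rw [hq c t ht.1]
      exact hasDerivAt_extendLeft ht.1 ((hX c).components ht).2.1 fun h0 => by rw [h0, hX0]
    · rw [hq c t ht.1, hp c t ht.1, hf c t ht.1]
      exact hasDerivAt_extendLeft ht.1 ((hX c).components ht).2.2 fun h0 => by rw [h0, hX0]
    · intro hTop R hR
      have hbd : ∀ t ∈ interval (lifespan β a b c), ‖X c t‖ ≤ R := by
        intro t ht
        obtain ⟨h1, h2, h3⟩ := hR t ht
        rw [hf c t ht.1] at h1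
        rw [hp c t ht.1] at h2
        rw [hq c t ht.1] at h3
        exact norm_prod_le_iff.2 ⟨h1, norm_prod_le_iff.2 ⟨h2, h3⟩⟩
      obtain ⟨τ, hτ⟩ : ∃ τ : ℝ, lifespan β a b c = τ :=
        ⟨_, (EReal.coe_toReal hTop (ne_bot_of_gt (hT c))).symm⟩
      have hXc := hX c
      have hTc := hT c
      rw [hτ] at hXc hbd hTc
      obtain ⟨Y, S, hS, hY, hY0⟩ := hXc.exists_extension (by exact_mod_cast hTc) hbd
      have := hlong c Y S (hTc.trans hS) hY (hY0.trans (hX0 c))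
      rw [hτ] at this
      exact absurd hS (not_lt.2 this)
  · rw [hf c t ht.1]
    exact (hXf c t).symm
  · obtain ⟨δ, hδ, hnear⟩ := (hX c).exists_isFlow_near ht hε
    filter_upwards [Metric.ball_mem_nhds c hδ] with c' hc'
    obtain ⟨Y, S, hS, hY, hY0, hd⟩ := hnear (a, b, c') (by
      rw [hX0, Prod.dist_eq, Prod.dist_eq]
      simpa using hc')
    have hS0 : (0 : EReal) < S := lt_of_le_of_lt (by exact_mod_cast ht.1) hS
    have ht' : t ∈ interval (lifespan β a b c') :=
      ⟨ht.1, hS.trans_le (hlong c' Y S hS0 hY hY0)⟩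
    refine ⟨ht', fun s hs => ?_⟩
    have hYX : Y s = X c' s := hY.eqOn (hX c') (hY0.trans (hX0 c').symm)
      (mem_interval_of_le ⟨ht.1, hS⟩ hs.1 hs.2) (mem_interval_of_le ht' hs.1 hs.2)
    have h1 := hd s hs
    rw [hYX] at h1
    have h2 : dist (X c' s).2 (X c s).2 < ε := (le_max_right _ _).trans_lt h1
    rw [hp c' s hs.1, hp c s hs.1, hq c' s hs.1, hq c s hs.1]
    exact ⟨(le_max_left _ _).trans_lt h2, (le_max_right _ _).trans_lt h2⟩

namespace IsMaxTraj

variable {β a b c : ℝ} {f p q : ℝ → ℝ} {T : EReal}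

theorem trichotomy (h : IsMaxTraj β a b c f p q T) :
    IsBlowUp p q T ∨ IsCritical f p q T ∨ IsRegular p T := by
  rcases lt_or_ge c 0 with hc | hc
  · rcases h.classification hc with h1 | h1 | h1
    · exact Or.inl h1
    · exact Or.inr (Or.inl h1)
    · exact Or.inr (Or.inr h1.1)
  · right; right
    by_cases hne : b = 1 ∧ c = 0
    · obtain ⟨rfl, rfl⟩ := hne
      have hT := h.eq_top fun t ht => by rw [(h.stationary ht).1]; exact one_pos
      have hp : ∀ t, 0 ≤ t → p t = 1 := fun t ht =>
        (h.stationary (by rw [hT, interval_top]; exact ht)).1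
      refine ⟨hT, fun t ht => by rw [hp t ht]; exact one_pos, ?_⟩
      refine tendsto_const_nhds.congr' ?_
      filter_upwards [eventually_ge_atTop 0] with t ht using (hp t ht).symm
    · have := mul_nonneg h.a_nonneg (sub_nonneg.2 h.one_le_b)
      exact (h.regular_of_ge (by linarith) hne).1

/-- For `c ≥ -a (b - 1)`, `f' ≥ 1` on the whole interval of existence. -/
theorem one_le_of_ge (h : IsMaxTraj β a b c f p q T) (hc : -a * (b - 1) ≤ c) :
    ∀ t ∈ interval T, 1 ≤ p t := by
  intro t ht
  by_cases hne : b = 1 ∧ c = 0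
  · obtain ⟨rfl, rfl⟩ := hne
    exact (h.stationary ht).1.ge
  · rcases ht.1.eq_or_lt with rfl | h0
    · rw [h.p_zero]; exact h.one_le_b
    · exact (h.one_lt hc hne ht h0).le

theorem IsBlowUp.not_isRegular (hB : IsBlowUp p q T) : ¬ IsRegular p T :=
  fun hR => hB.1.ne hR.1

theorem IsCritical.not_isRegular (hC : IsCritical f p q T) : ¬ IsRegular p T :=
  fun hR => zero_ne_one (tendsto_nhds_unique hC.2.2.1 hR.2.2)

/-- A solution with `f' ≥ 1` is regular. -/
theorem regular_of_one_le (h : IsMaxTraj β a b c f p q T) (hp : ∀ t ∈ interval T, 1 ≤ p t) :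
    IsRegular p T := by
  rcases h.trichotomy with ⟨-, s, hs, hps, -⟩ | ⟨hT, -, hl, -⟩ | h1
  · linarith [hp s hs]
  · have : (1 : ℝ) ≤ 0 := ge_of_tendsto hl (by
      filter_upwards [eventually_ge_atTop 0] with t ht
      exact hp t (by rw [hT, interval_top]; exact ht))
    linarith
  · exact h1

/-- Along a regular solution the energy becomes negative. -/
theorem exists_energy_neg (h : IsMaxTraj β a b c f p q T) (hR : IsRegular p T) :
    ∃ t ∈ interval T, (∀ x ∈ Icc 0 t, 0 < p x) ∧
      q t ^ 2 / 2 + β * (p t ^ 3 / 3 - p t ^ 2 / 2) < 0 := by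
  obtain ⟨hT, hpos, hl⟩ := hR
  have hβ := h.β_pos
  have hβ1 := h.β_le
  have hmem : ∀ t : ℝ, 0 ≤ t → t ∈ interval T := fun t ht => by
    rw [hT, interval_top]; exact ht
  have h1 : Tendsto (fun t => p t ^ 3 / 3 - p t ^ 2 / 2) atTop (𝓝 (1 ^ 3 / 3 - 1 ^ 2 / 2)) :=
    ((hl.pow 3).div_const 3).sub ((hl.pow 2).div_const 2)
  obtain ⟨s, hs⟩ := eventually_atTop.1
    ((h1.eventually_lt_const (show (1 ^ 3 / 3 - 1 ^ 2 / 2 : ℝ) < -(1 / 12) by norm_num)).and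
      (((hl.eventually_lt_const (show (1 : ℝ) < 1 + β / 6 by linarith)).and
      (hl.eventually_const_lt (show 1 - β / 6 < (1 : ℝ) by linarith))).and
      (eventually_ge_atTop (0 : ℝ))))
  have hs0 := (hs s le_rfl).2.2
  -- `f''` is small at some point of `[s, s + 1]`, by the mean value theorem
  obtain ⟨x, hx, hqx⟩ := exists_hasDerivAt_eq_slope p q (lt_add_one s)
    (h.continuousOn_p (hmem _ (by linarith)) hs0)
    (fun x hx => h.hp x (hmem x (hs0.trans hx.1.le)))
  rw [add_sub_cancel_left, div_one] at hqx
  refine ⟨x, hmem x (hs0.trans hx.1.le), fun y hy => hpos y hy.1, ?_⟩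
  have h2 := (hs x hx.1.le).1
  obtain ⟨h3, h4⟩ := (hs s le_rfl).2.1
  obtain ⟨h5, h6⟩ := (hs (s + 1) (by linarith)).2.1
  have h7 : q x ^ 2 ≤ (β / 3) ^ 2 := sq_le_sq' (by linarith) (by linarith)
  nlinarith

/-- If the energy becomes negative before `f'` vanishes, the solution is regular: the energy
decreases, while it is nonnegative where `f' = 0` and tends to `0` along a critical solution. -/
theorem regular_of_energy_neg (h : IsMaxTraj β a b c f p q T) {t : ℝ} (ht : t ∈ interval T)
    (hpos : ∀ x ∈ Icc 0 t, 0 < p x)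
    (hE : q t ^ 2 / 2 + β * (p t ^ 3 / 3 - p t ^ 2 / 2) < 0) : IsRegular p T := by
  rcases h.trichotomy with ⟨-, s, hs, hps, hqs⟩ | ⟨hT, hpq, hp, hq, -⟩ | h1
  · exfalso
    have hts : t < s := by
      by_contra hcon
      linarith [hpos s ⟨hs.1, not_lt.1 hcon⟩]
    have h1 := h.energy_le ht.1 hts.le hs fun x hx => by
      have := le_of_hasDerivAt_nonneg (g := fun z => -p z) (g' := fun z => -q z) hx.2.le
        (h.continuousOn_p hs hx.1.le).neg
        (fun z hz => (h.hp z (mem_interval_of_le hs (hx.1.le.trans hz.1.le) hz.2.le)).neg)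
        (fun z hz => by linarith [hqs z ⟨hx.1.le.trans hz.1.le, hz.2.le⟩])
      linarith
    rw [hps] at h1
    have := sq_nonneg (q s)
    linarith
  · exfalso
    have h1 : Tendsto (fun t => q t ^ 2 / 2 + β * (p t ^ 3 / 3 - p t ^ 2 / 2)) atTop
        (𝓝 (0 ^ 2 / 2 + β * (0 ^ 3 / 3 - 0 ^ 2 / 2))) :=
      ((hq.pow 2).div_const 2).add ((((hp.pow 3).div_const 3).sub
        ((hp.pow 2).div_const 2)).const_mul β)
    have h2 := le_of_tendsto h1 (by
      filter_upwards [eventually_ge_atTop t] with x hx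
      exact h.energy_le ht.1 hx (by rw [hT, interval_top]; exact ht.1.trans hx)
        fun y hy => (hpq y hy.1.le).1.le)
    norm_num at h2
    linarith
  · exact h1

/-- If `c < 0`, then `f' ≤ b` as long as `f' > 0`. -/
theorem p_le_b (h : IsMaxTraj β a b c f p q T) (hc : c < 0) {t : ℝ} (ht : t ∈ interval T)
    (hpos : ∀ x ∈ Icc 0 t, 0 < p x) : p t ≤ b := by
  by_cases hq : ∀ x ∈ Icc 0 t, q x < 0
  · have := le_of_hasDerivAt_nonneg (g := fun z => -p z) (g' := fun z => -q z) ht.1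
      (h.continuousOn_p ht le_rfl).neg
      (fun z hz => (h.hp z (mem_interval_of_le ht hz.1.le hz.2.le)).neg)
      (fun z hz => by linarith [hq z (Ioo_subset_Icc_self hz)])
    rw [h.p_zero] at this
    linarith
  · push Not at hq
    obtain ⟨r, hr, hqr⟩ := hq
    obtain ⟨x, hx, hqx, hneg⟩ := exists_first_zero hr.1
      (h.continuousOn_q (mem_interval_of_le ht hr.1 hr.2) le_rfl) (by rw [h.q_zero]; exact hc) hqr
    have hxt : x ∈ Icc 0 t := ⟨hx.1.le, hx.2.trans hr.2⟩
    have hb := h.one_le_b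
    rcases hxt.2.eq_or_lt with rfl | hlt
    · linarith [(h.lt_one_of_first_zero hc ht (hpos _ hxt) hqx hneg).2]
    · linarith [(h.after_first_zero hc ht hxt hpos hqx hneg t ⟨hlt, le_rfl⟩).2]

/-- For very negative `c` the solution blows up: `f'` vanishes before the time `1`. -/
theorem blowUp_of_le (h : IsMaxTraj β a b c f p q T)
    (hc : c ≤ -(a * b + b ^ 2 + 2 * b + 1)) : IsBlowUp p q T := by
  have ha := h.a_nonneg
  have hb := h.one_le_b
  have hβ := h.β_pos
  have hc0 : c < 0 := by nlinarith [mul_nonneg ha (by linarith : (0 : ℝ) ≤ b)]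
  by_contra hB
  obtain ⟨hT, hpos⟩ : T = ⊤ ∧ ∀ t, 0 ≤ t → 0 < p t := by
    rcases h.trichotomy with h1 | h1 | h1
    · exact absurd h1 hB
    · exact ⟨h1.1, fun t ht => (h1.2.1 t ht).1⟩
    · exact ⟨h1.1, h1.2.1⟩
  have hmem : ∀ t : ℝ, 0 ≤ t → t ∈ interval T := fun t ht => by
    rw [hT, interval_top]; exact ht
  have hpb : ∀ t, 0 ≤ t → p t ≤ b := fun t ht =>
    h.p_le_b hc0 (hmem t ht) fun x hx => hpos x hx.1
  have hq : ∀ t ∈ Icc (0 : ℝ) 1, q t ≤ -(b + 1) := by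
    intro t ht
    have hd : ∀ x, 0 ≤ x → HasDerivAt (fun x => (b ^ 2 + b) * x - (q x + f x * p x))
        ((b ^ 2 + b) * 1 - p x * ((1 - β) * p x + β)) x := fun x hx =>
      ((hasDerivAt_id x).const_mul _).sub (h.hasDerivAt_q_add_mul (hmem x hx))
    have := le_of_hasDerivAt_nonneg ht.1
      (fun x hx => (hd x hx.1).continuousAt.continuousWithinAt) (fun x hx => hd x hx.1.le)
      (fun x hx => by
        have h1 := hpos x hx.1.le
        have h2 := hpb x hx.1.le
        have h3 := h.β_le
        have h4 : (1 - β) * p x + β ≤ b + 1 := by nlinarith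
        have h5 : p x * ((1 - β) * p x + β) ≤ b * (b + 1) :=
          mul_le_mul h2 h4 (by have := sub_nonneg.2 h3; positivity) (by linarith)
        linarith)
    simp only [h.q_zero, h.f_zero, h.p_zero, mul_zero] at this
    have h6 : 0 ≤ f t * p t := mul_nonneg (ha.trans (h.a_le_f (hmem t ht.1)
      fun y hy => (hpos y hy.1.le).le)) (hpos t ht.1).le
    have h7 : (b ^ 2 + b) * t ≤ (b ^ 2 + b) * 1 := by
      gcongr
      exact ht.2
    linarith
  have := le_of_hasDerivAt_nonneg (g := fun x => -(b + 1) * x - p x)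
    (g' := fun x => -(b + 1) * 1 - q x) zero_le_one
    ((by fun_prop : Continuous fun x : ℝ => -(b + 1) * x).continuousOn.sub
      (h.continuousOn_p (hmem 1 zero_le_one) le_rfl))
    (fun x hx => ((hasDerivAt_id x).const_mul _).sub (h.hp x (hmem x hx.1.le)))
    (fun x hx => by linarith [hq x (Ioo_subset_Icc_self hx)])
  rw [h.p_zero] at this
  linarith [hpos 1 zero_le_one]

/-- Below a value of `c` whose solution is not regular, all solutions blow up. In particular there
is at most one critical solution: for two of them, `q + f p` tends to `0`, which contradicts the
last inequality of `comparison`. -/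
theorem blowUp_of_lt_of_not_regular {c₁ c₂ : ℝ} {f₁ p₁ q₁ f₂ p₂ q₂ : ℝ → ℝ} {T₁ T₂ : EReal}
    (h₁ : IsMaxTraj β a b c₁ f₁ p₁ q₁ T₁) (h₂ : IsMaxTraj β a b c₂ f₂ p₂ q₂ T₂) (hc : c₁ < c₂)
    (hR : ¬ IsRegular p₂ T₂) : IsBlowUp p₁ q₁ T₁ := by
  rcases h₂.trichotomy with ⟨-, s, hs, hps, hqs⟩ | ⟨hT₂, hpq₂, hl₂, -, B, hB⟩ | h3
  · obtain ⟨t, ht, hpt, hqt, -, -⟩ := h₁.comparison h₂ hc hs hqs hps.ge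
    rw [hps] at hpt
    exact ⟨h₁.lt_top_of_hit_zero ht hpt (hqt t ⟨ht.1, le_rfl⟩), t, ht, hpt, hqt⟩
  · have hmem₂ : ∀ t : ℝ, 0 ≤ t → t ∈ interval T₂ := fun t ht => by
      rw [hT₂, interval_top]; exact ht
    have hc₂ : c₂ < 0 := by
      have := (hpq₂ 0 le_rfl).2
      rwa [h₂.q_zero] at this
    have hcmp : ∀ t₂, 0 ≤ t₂ → ∃ t₁ ∈ interval T₁, p₁ t₁ = p₂ t₂ ∧ (∀ x ∈ Icc 0 t₁, q₁ x < 0) ∧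
        q₁ t₁ < q₂ t₂ ∧ c₂ - c₁ ≤ (q₂ t₂ + f₂ t₂ * p₂ t₂) - (q₁ t₁ + f₁ t₁ * p₁ t₁) :=
      fun t₂ ht₂ => h₁.comparison h₂ hc (hmem₂ t₂ ht₂) (fun x hx => (hpq₂ x hx.1).2)
        (hpq₂ t₂ ht₂).1.le
    have hanti : ∀ s t, t ∈ interval T₁ → 0 ≤ s → s ≤ t → (∀ x ∈ Ioo s t, q₁ x < 0) →
        p₁ t ≤ p₁ s := by
      intro s t ht hs hst hq
      have := le_of_hasDerivAt_nonneg (g := fun z => -p₁ z) (g' := fun z => -q₁ z) hst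
        (h₁.continuousOn_p ht hs).neg
        (fun z hz => (h₁.hp z (mem_interval_of_le ht (hs.trans hz.1.le) hz.2.le)).neg)
        (fun z hz => by linarith [hq z hz])
      linarith
    have hlow : ∀ m > 0, ∃ t₂, 0 ≤ t₂ ∧ p₂ t₂ < m := fun m hm => by
      obtain ⟨t, ht, ht0⟩ := ((hl₂.eventually_lt_const hm).and (eventually_ge_atTop 0)).exists
      exact ⟨t, ht0, ht⟩
    rcases h₁.classification (hc.trans hc₂) with h4 | ⟨hT₁, hpq₁, hl₁, hq₁, -⟩ | ⟨⟨hT₁, hpos₁, -⟩, h4⟩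
    · exact h4
    · exfalso
      have hmem₁ : ∀ t : ℝ, 0 ≤ t → t ∈ interval T₁ := fun t ht => by
        rw [hT₁, interval_top]; exact ht
      obtain ⟨S, hS⟩ := eventually_atTop.1 ((hq₁.eventually_const_lt
        (show -((c₂ - c₁) / 2) < 0 by linarith)).and (eventually_ge_atTop (0 : ℝ)))
      have hS0 := (hS S le_rfl).2
      have hB0 : 0 ≤ |B| := abs_nonneg B
      obtain ⟨t₂, ht₂, hpt₂⟩ := hlow (min (p₁ S) ((c₂ - c₁) / 2 / (|B| + 1)))
        (lt_min (hpq₁ S hS0).1 (by have := sub_pos.2 hc; positivity))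
      obtain ⟨t₁, ht₁, hpt, -, -, hW⟩ := hcmp t₂ ht₂
      have hSt : S ≤ t₁ := by
        by_contra hcon
        have := hanti t₁ S (hmem₁ S hS0) ht₁.1 (not_le.1 hcon).le
          fun x hx => (hpq₁ x (ht₁.1.trans hx.1.le)).2
        linarith [hpt₂.trans_le (min_le_left _ _)]
      have h5 := (hS t₁ hSt).1
      have h6 := (hpq₂ t₂ ht₂)
      have h7 : f₂ t₂ * p₂ t₂ ≤ (|B| + 1) * p₂ t₂ :=
        mul_le_mul_of_nonneg_right (by linarith [hB t₂ ht₂, le_abs_self B]) h6.1.le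
      have h8 : p₂ t₂ * (|B| + 1) < (c₂ - c₁) / 2 :=
        (lt_div_iff₀ (by positivity)).1 (hpt₂.trans_le (min_le_right _ _))
      have h9 : 0 ≤ f₁ t₁ * p₁ t₁ := mul_nonneg (h₁.a_nonneg.trans (h₁.a_le_f ht₁
        fun y hy => (hpq₁ y hy.1.le).1.le)) (hpq₁ t₁ ht₁.1).1.le
      linarith
    · exfalso
      rcases h4 with ⟨-, hone⟩ | ⟨x, hx0, -, hneg, hqx, -⟩
      · obtain ⟨t₂, ht₂, hpt₂⟩ := hlow 1 one_pos
        obtain ⟨t₁, ht₁, hpt, -⟩ := hcmp t₂ ht₂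
        rcases ht₁.1.eq_or_lt with h0 | h0
        · rw [← h0, h₁.p_zero] at hpt
          linarith [h₁.one_le_b]
        · linarith [hone t₁ h0]
      · obtain ⟨t₂, ht₂, hpt₂⟩ := hlow (p₁ x) (hpos₁ x hx0.le)
        obtain ⟨t₁, ht₁, hpt, hqt, -⟩ := hcmp t₂ ht₂
        have htx : t₁ < x := by
          by_contra hcon
          linarith [hqt x ⟨hx0.le, not_lt.1 hcon⟩]
        have := hanti t₁ x (by rw [hT₁, interval_top]; exact hx0.le) ht₁.1 htx.le
          fun y hy => hneg y ⟨ht₁.1.trans hy.1.le, hy.2⟩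
        linarith
  · exact absurd h3 hR

/-- The property `f' ≥ 1` passes from `c₁` to larger values `c₂ < 0`. -/
theorem one_le_of_lt {c₁ c₂ : ℝ} {f₁ p₁ q₁ f₂ p₂ q₂ : ℝ → ℝ} {T₁ T₂ : EReal}
    (h₁ : IsMaxTraj β a b c₁ f₁ p₁ q₁ T₁) (h₂ : IsMaxTraj β a b c₂ f₂ p₂ q₂ T₂) (hc : c₁ < c₂)
    (hc₂ : c₂ < 0) (hp₁ : ∀ t ∈ interval T₁, 1 ≤ p₁ t) : ∀ t ∈ interval T₂, 1 ≤ p₂ t := by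
  intro t ht
  by_contra hlt
  obtain ⟨s, hs, hps, hqs⟩ := h₂.exists_hit_one hc₂ ht (not_le.1 hlt)
  obtain ⟨r, hr, hpr, hqr, -⟩ := h₁.comparison h₂ hc (mem_interval_of_le ht hs.1 hs.2) hqs
    (by rw [hps]; exact zero_le_one)
  obtain ⟨u, hu, huT⟩ := exists_gt_mem_interval hr
  obtain ⟨v, hv, hv'⟩ := exists_lt_right_of_hasDerivAt_neg hu (h₁.hp r hr)
    (hqr r ⟨hr.1, le_rfl⟩)
  have h3 := hv' v ⟨hv.1, le_rfl⟩
  linarith [hp₁ v (mem_interval_of_le huT (hr.1.trans hv.1.le) hv.2.le)]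

/-! ### Convexity -/

theorem continuousOn_of_subset (h : IsMaxTraj β a b c f p q T) {D : Set ℝ} (hD : D ⊆ interval T) :
    ContinuousOn f D := fun x hx => (h.hf x (hD hx)).continuousAt.continuousWithinAt

theorem strictConvexOn (h : IsMaxTraj β a b c f p q T) {D : Set ℝ} (hD : Convex ℝ D)
    (hDT : D ⊆ interval T) (hq : ∀ x ∈ interior D, 0 < q x) : StrictConvexOn ℝ D f := by
  refine StrictMonoOn.strictConvexOn_of_deriv hD (h.continuousOn_of_subset hDT) ?_
  intro x hx y hy hxy
  have hsub : Icc x y ⊆ interior D := hD.interior.ordConnected.out hx hy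
  have hT : ∀ z ∈ interior D, z ∈ interval T := fun z hz => hDT (interior_subset hz)
  rw [(h.hf x (hT x hx)).deriv, (h.hf y (hT y hy)).deriv]
  exact lt_of_hasDerivAt_pos hxy (h.continuousOn_p (hT y hy) (hT x hx).1)
    (fun z hz => h.hp z (hT z (hsub (Ioo_subset_Icc_self hz))))
    (fun z hz => hq z (hsub (Ioo_subset_Icc_self hz)))

theorem strictConcaveOn (h : IsMaxTraj β a b c f p q T) {D : Set ℝ} (hD : Convex ℝ D)
    (hDT : D ⊆ interval T) (hq : ∀ x ∈ interior D, q x < 0) : StrictConcaveOn ℝ D f := by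
  refine StrictAntiOn.strictConcaveOn_of_deriv hD (h.continuousOn_of_subset hDT) ?_
  intro x hx y hy hxy
  have hsub : Icc x y ⊆ interior D := hD.interior.ordConnected.out hx hy
  have hT : ∀ z ∈ interior D, z ∈ interval T := fun z hz => hDT (interior_subset hz)
  rw [(h.hf x (hT x hx)).deriv, (h.hf y (hT y hy)).deriv]
  have := lt_of_hasDerivAt_pos (g := fun z => -p z) (g' := fun z => -q z) hxy
    (h.continuousOn_p (hT y hy) (hT x hx).1).neg
    (fun z hz => (h.hp z (hT z (hsub (Ioo_subset_Icc_self hz)))).neg)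
    (fun z hz => by linarith [hq z (hsub (Ioo_subset_Icc_self hz))])
  linarith

theorem concaveOn (h : IsMaxTraj β a b c f p q T) {D : Set ℝ} (hD : Convex ℝ D)
    (hDT : D ⊆ interval T) (hq : ∀ x ∈ interior D, q x ≤ 0) : ConcaveOn ℝ D f := by
  have hT : ∀ z ∈ interior D, z ∈ interval T := fun z hz => hDT (interior_subset hz)
  refine AntitoneOn.concaveOn_of_deriv hD (h.continuousOn_of_subset hDT)
    (fun x hx => (h.hf x (hT x hx)).differentiableAt.differentiableWithinAt) ?_
  intro x hx y hy hxy
  have hsub : Icc x y ⊆ interior D := hD.interior.ordConnected.out hx hy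
  rw [(h.hf x (hT x hx)).deriv, (h.hf y (hT y hy)).deriv]
  have := le_of_hasDerivAt_nonneg (g := fun z => -p z) (g' := fun z => -q z) hxy
    (h.continuousOn_p (hT y hy) (hT x hx).1).neg
    (fun z hz => (h.hp z (hT z (hsub (Ioo_subset_Icc_self hz)))).neg)
    (fun z hz => by linarith [hq z (hsub (Ioo_subset_Icc_self hz))])
  linarith

end IsMaxTraj

/-! ### Boundary value problems and the threshold values of `c` -/

theorem IsBVPSolution.isShootingOn {β a b l : ℝ} {g : ℝ → ℝ} (h : IsBVPSolution β a b l g) :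
    IsShootingOn β a b (iteratedDerivWithin 2 g (Ici 0) 0) g ⊤ := by
  obtain ⟨h1, h2, h3, -⟩ := h
  rw [← interval_top] at h1 h3 ⊢
  exact ⟨by simp, h1, h2, h3, rfl⟩

/-- A global shooting solution with `f' → l` solves the boundary value problem. -/
theorem isBVPSolution_of_tendsto {β a b c l : ℝ} {f p q : ℝ → ℝ}
    (h : IsMaxTraj β a b c f p q (lifespan β a b c)) (hT : lifespan β a b c = ⊤)
    (hf : EqOn (shoot β a b c) f (interval (lifespan β a b c))) (hl : Tendsto p atTop (𝓝 l)) :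
    IsBVPSolution β a b l (shoot β a b c) := by
  obtain ⟨-, h1, h2, h3, -⟩ := (isMaximalShooting_shoot β a b c).1
  rw [hT, interval_top] at h1 h3
  refine ⟨h1, h2, h3, hl.congr' ?_⟩
  rw [hT, interval_top] at hf
  filter_upwards [eventually_ge_atTop 0] with t ht
  exact (((h.hf t (by rw [hT, interval_top]; exact ht)).hasDerivWithinAt.congr hf
    (hf ht)).derivWithin (uniqueDiffOn_Ici 0 t ht)).symm

section Family

variable {β a b : ℝ} {f p q : ℝ → ℝ → ℝ} {T : ℝ → EReal}

/-- Continuous dependence on `c` of the shooting solutions, on compact time intervals. -/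
def DependsContinuously (p q : ℝ → ℝ → ℝ) (T : ℝ → EReal) : Prop :=
  ∀ c, ∀ t ∈ interval (T c), ∀ ε > 0, ∀ᶠ c' in 𝓝 c,
    t ∈ interval (T c') ∧ ∀ s ∈ Icc 0 t, |p c' s - p c s| < ε ∧ |q c' s - q c s| < ε

theorem DependsContinuously.tendsto (h : DependsContinuously p q T) {c t : ℝ}
    (ht : t ∈ interval (T c)) :
    Tendsto (fun c' => p c' t) (𝓝 c) (𝓝 (p c t)) ∧
      Tendsto (fun c' => q c' t) (𝓝 c) (𝓝 (q c t)) := by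
  have htt : t ∈ Icc 0 t := ⟨ht.1, le_rfl⟩
  constructor <;> refine Metric.tendsto_nhds.2 fun ε hε => ?_
  · filter_upwards [h c t ht ε hε] with c' hc' using (hc'.2 t htt).1
  · filter_upwards [h c t ht ε hε] with c' hc' using (hc'.2 t htt).2

theorem DependsContinuously.isOpen_regular (h : DependsContinuously p q T)
    (hfam : ∀ c, IsMaxTraj β a b c (f c) (p c) (q c) (T c)) :
    IsOpen {c | IsMaxTraj.IsRegular (p c) (T c)} := by
  refine isOpen_iff_mem_nhds.2 fun c hc => ?_
  obtain ⟨t, ht, hpos, hE⟩ := (hfam c).exists_energy_neg hc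
  obtain ⟨m, hm, hmin⟩ := isCompact_Icc.exists_isMinOn ⟨0, le_rfl, ht.1⟩
    ((hfam c).continuousOn_p ht le_rfl)
  obtain ⟨hp, hq⟩ := h.tendsto ht
  have hEt : Tendsto (fun c' => q c' t ^ 2 / 2 + β * (p c' t ^ 3 / 3 - p c' t ^ 2 / 2)) (𝓝 c)
      (𝓝 (q c t ^ 2 / 2 + β * (p c t ^ 3 / 3 - p c t ^ 2 / 2))) :=
    ((hq.pow 2).div_const 2).add ((((hp.pow 3).div_const 3).sub
      ((hp.pow 2).div_const 2)).const_mul β)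
  filter_upwards [h c t ht _ (hpos m hm), hEt.eventually_lt_const hE] with c' h1 h2
  refine (hfam c').regular_of_energy_neg h1.1 (fun x hx => ?_) h2
  have h3 := (abs_lt.1 (h1.2 x hx).1).1
  have h4 : p c m ≤ p c x := hmin hx
  linarith

theorem DependsContinuously.isOpen_blowUp (h : DependsContinuously p q T)
    (hfam : ∀ c, IsMaxTraj β a b c (f c) (p c) (q c) (T c)) :
    IsOpen {c | IsMaxTraj.IsBlowUp (p c) (q c) (T c)} := by
  refine isOpen_iff_mem_nhds.2 fun c hc => ?_
  obtain ⟨-, s, hs, hps, hqs⟩ := hc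
  obtain ⟨u, hu, huT⟩ := exists_gt_mem_interval hs
  obtain ⟨r, hr, hr'⟩ := exists_lt_right_of_hasDerivAt_neg hu ((hfam c).hp s hs)
    (hqs s ⟨hs.1, le_rfl⟩)
  have hr0 : 0 ≤ r := hs.1.trans hr.1.le
  have hpr : p c r < 0 := by
    rw [← hps]
    exact hr' r ⟨hr.1, le_rfl⟩
  have hrT := mem_interval_of_le huT hr0 hr.2.le
  filter_upwards [(h.tendsto hrT).1.eventually_lt_const hpr] with c' h2
  rcases (hfam c').trichotomy with h3 | h3 | h3
  · exact h3
  · linarith [(h3.2.1 r hr0).1]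
  · linarith [h3.2.1 r hr0]

theorem DependsContinuously.isClosed_one_le (h : DependsContinuously p q T) :
    IsClosed {c | ∀ t ∈ interval (T c), 1 ≤ p c t} := by
  rw [← isOpen_compl_iff]
  refine isOpen_iff_mem_nhds.2 fun c hc => ?_
  simp only [mem_compl_iff, mem_ofPred_eq, not_forall, not_le] at hc
  obtain ⟨t, ht, hpt⟩ := hc
  filter_upwards [h c t ht 1 one_pos, (h.tendsto ht).1.eventually_lt_const hpt] with c' h1 h2 h3
  exact absurd (h3 t h1.1) (not_le.2 h2)

/-- The critical value of `c` separates blow-up from regular solutions. -/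
theorem exists_critical (h : DependsContinuously p q T)
    (hfam : ∀ c, IsMaxTraj β a b c (f c) (p c) (q c) (T c)) :
    ∃ c₀ < 0, IsMaxTraj.IsCritical (f c₀) (p c₀) (q c₀) (T c₀) ∧
      (∀ c < c₀, IsMaxTraj.IsBlowUp (p c) (q c) (T c)) ∧
      ∀ c, c₀ < c → IsMaxTraj.IsRegular (p c) (T c) := by
  set S : Set ℝ := {c | ¬ IsMaxTraj.IsRegular (p c) (T c)} with hS
  have h0 := hfam 0
  have hab := mul_nonneg h0.a_nonneg (sub_nonneg.2 h0.one_le_b)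
  have hneg : ∀ c ∈ S, c < 0 := by
    intro c hc
    by_contra hc0
    exact hc ((hfam c).regular_of_one_le ((hfam c).one_le_of_ge (by linarith)))
  have hne : S.Nonempty :=
    ⟨-(a * b + b ^ 2 + 2 * b + 1), ((hfam _).blowUp_of_le le_rfl).not_isRegular⟩
  have hbdd : BddAbove S := ⟨0, fun c hc => (hneg c hc).le⟩
  have hcl : IsClosed S := (h.isOpen_regular hfam).isClosed_compl
  have hmem : sSup S ∈ S := hcl.csSup_mem hne hbdd
  have hreg : ∀ c, sSup S < c → IsMaxTraj.IsRegular (p c) (T c) := by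
    intro c hc
    by_contra hcon
    exact absurd (le_csSup hbdd hcon) (not_le.2 hc)
  refine ⟨sSup S, hneg _ hmem, ?_, fun c hc =>
    (hfam c).blowUp_of_lt_of_not_regular (hfam _) hc hmem, hreg⟩
  rcases (hfam (sSup S)).trichotomy with h1 | h1 | h1
  · -- blow-up is an open condition, so it would persist for some larger `c`
    exfalso
    obtain ⟨ε, hε, hball⟩ := Metric.isOpen_iff.1 (h.isOpen_blowUp hfam) _ h1
    have h2 : sSup S + ε / 2 ∈ Metric.ball (sSup S) ε := by
      rw [Metric.mem_ball, Real.dist_eq, add_sub_cancel_left, abs_of_pos (by linarith)]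
      linarith
    exact (hball h2).not_isRegular (hreg _ (by linarith))
  · exact h1
  · exact absurd h1 hmem

/-- The least `c ≤ 0` with `f' ≥ 1`. -/
theorem exists_concave_threshold (h : DependsContinuously p q T)
    (hfam : ∀ c, IsMaxTraj β a b c (f c) (p c) (q c) (T c)) {c₀ : ℝ}
    (hlow : ∀ c ≤ c₀, ¬ IsMaxTraj.IsRegular (p c) (T c)) :
    ∃ c₁, c₀ < c₁ ∧ c₁ ≤ -a * (b - 1) ∧ (∀ c ∈ Icc c₁ 0, ∀ t ∈ interval (T c), 1 ≤ p c t) ∧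
      ∀ c < c₁, ¬ ∀ t ∈ interval (T c), 1 ≤ p c t := by
  have hab := mul_nonneg (hfam 0).a_nonneg (sub_nonneg.2 (hfam 0).one_le_b)
  set A : Set ℝ := Iic 0 ∩ {c | ∀ t ∈ interval (T c), 1 ≤ p c t} with hA
  have hA0 : -a * (b - 1) ∈ A :=
    ⟨show -a * (b - 1) ≤ 0 by linarith, (hfam _).one_le_of_ge le_rfl⟩
  have hgt : ∀ c, (∀ t ∈ interval (T c), 1 ≤ p c t) → c₀ < c := fun c hc => by
    by_contra hcon
    exact hlow c (not_lt.1 hcon) ((hfam c).regular_of_one_le hc)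
  have hbdd : BddBelow A := ⟨c₀, fun c hc => (hgt c hc.2).le⟩
  have hmem : sInf A ∈ A := (isClosed_Iic.inter h.isClosed_one_le).csInf_mem ⟨_, hA0⟩ hbdd
  refine ⟨sInf A, hgt _ hmem.2, csInf_le hbdd hA0, fun c hc => ?_, fun c hc hcon => ?_⟩
  · rcases hc.1.eq_or_lt with h1 | h1
    · rw [← h1]; exact hmem.2
    rcases hc.2.eq_or_lt with rfl | h2
    · exact (hfam _).one_le_of_ge (by linarith)
    · exact (hfam _).one_le_of_lt (hfam c) h1 h2 hmem.2
  · exact absurd (csInf_le hbdd ⟨show c ≤ 0 from hc.le.trans hmem.1, hcon⟩) (not_le.2 hc)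

end Family

end MixedConvection

theorem mainTheorem1 (β a b : ℝ) (hβ : β ∈ Ioc (0 : ℝ) 1) (ha : 0 ≤ a) (hb : 1 ≤ b) :
    (∀ c : ℝ, MixedConvection.IsMaximalShooting β a b c
      (MixedConvection.shoot β a b c) (MixedConvection.lifespan β a b c)) ∧
    ∃ cLow : ℝ, cLow < 0 ∧
      (∀ c : ℝ, c < cLow → MixedConvection.lifespan β a b c < ⊤) ∧
      (∀ c : ℝ, cLow ≤ c → MixedConvection.lifespan β a b c = ⊤) ∧
      (MixedConvection.IsBVPSolution β a b 0 (MixedConvection.shoot β a b cLow) ∧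
        ConcaveOn ℝ (Ici 0) (MixedConvection.shoot β a b cLow)) ∧
      (∀ g : ℝ → ℝ, MixedConvection.IsBVPSolution β a b 0 g →
        EqOn g (MixedConvection.shoot β a b cLow) (Ici 0)) ∧
      (∀ c : ℝ, cLow < c →
        MixedConvection.IsBVPSolution β a b 1 (MixedConvection.shoot β a b c)) ∧
      ∃ cHigh : ℝ, cLow < cHigh ∧ cHigh ≤ -a * (b - 1) ∧
        (∀ c : ℝ, 0 < c →
          MixedConvection.IsConvexConcave (MixedConvection.shoot β a b c)) ∧
        (∀ c ∈ Icc cHigh 0, ConcaveOn ℝ (Ici 0) (MixedConvection.shoot β a b c)) ∧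
        (∀ c ∈ Ioo cLow cHigh,
          MixedConvection.IsConcaveConvex (MixedConvection.shoot β a b c)) := by
  open MixedConvection MixedConvection.IsMaxTraj in
  obtain ⟨f, p, q, hfam, hf, hdep⟩ := exists_family hβ ha hb
  have hdep' : DependsContinuously p q (lifespan β a b) := hdep
  obtain ⟨c₀, hc₀, hcrit, hblow, hreg⟩ := exists_critical hdep' hfam
  obtain ⟨c₁, hc₀₁, hc₁, hone, hnot⟩ := exists_concave_threshold hdep' hfam (c₀ := c₀)
    fun c hc => by
      rcases hc.eq_or_lt with rfl | h1
      · exact hcrit.not_isRegular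
      · exact (hblow c h1).not_isRegular
  have hab := mul_nonneg ha (sub_nonneg.2 hb)
  have hc₁0 : c₁ ≤ 0 := by linarith
  have hTop : ∀ c, c₀ ≤ c → lifespan β a b c = ⊤ := fun c hc => by
    rcases hc.eq_or_lt with rfl | h1
    · exact hcrit.1
    · exact (hreg c h1).1
  have hI : ∀ c, c₀ ≤ c → interval (lifespan β a b c) = Ici 0 := fun c hc => by
    rw [hTop c hc, interval_top]
  have hEq : ∀ c, c₀ ≤ c → EqOn (f c) (shoot β a b c) (Ici 0) := fun c hc => by
    rw [← hI c hc]; exact (hf c).symm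
  have hbvp : ∀ c, c₀ < c → IsBVPSolution β a b 1 (shoot β a b c) := fun c hc =>
    isBVPSolution_of_tendsto (hfam c) (hTop c hc.le) (hf c) (hreg c hc).2.2
  refine ⟨isMaximalShooting_shoot β a b, c₀, hc₀, fun c hc => (hblow c hc).1, hTop,
    ⟨isBVPSolution_of_tendsto (hfam c₀) hcrit.1 (hf c₀) hcrit.2.2.1, ?_⟩, ?_, hbvp, c₁, hc₀₁, hc₁,
    ?_, ?_, ?_⟩
  · refine ((hfam c₀).concaveOn (convex_Ici 0) (hI c₀ le_rfl).ge fun x hx => ?_).congr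
      (hEq c₀ le_rfl)
    exact (hcrit.2.1 x (interior_subset hx)).2.le
  · intro g hg
    obtain ⟨hle, hEqg⟩ := (isMaximalShooting_shoot β a b _).2 g ⊤ hg.isShootingOn
    set c := iteratedDerivWithin 2 g (Ici 0) 0 with hc
    rw [interval_top] at hEqg
    rcases lt_trichotomy c c₀ with h1 | h1 | h1
    · exact absurd (hblow c h1).1 (not_lt.2 hle)
    · rwa [h1] at hEqg
    · exfalso
      refine zero_ne_one (tendsto_nhds_unique hg.2.2.2 ((hbvp c h1).2.2.2.congr' ?_))
      filter_upwards [eventually_ge_atTop 0] with t ht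
      exact (derivWithin_congr hEqg (hEqg ht)).symm
  · intro c hc
    have hc₀c : c₀ ≤ c := by linarith
    obtain ⟨-, -, h1⟩ := (hfam c).regular_of_ge (by linarith) fun h2 => hc.ne' h2.2
    obtain ⟨s, hs, hpos, hneg⟩ := h1 hc
    refine ⟨s, hs, ?_, ?_⟩
    · refine ((hfam c).strictConvexOn (convex_Icc 0 s) ?_ fun x hx => ?_).congr
        ((hEq c hc₀c).mono Icc_subset_Ici_self)
      · rw [hI c hc₀c]; exact Icc_subset_Ici_self
      · rw [interior_Icc] at hx
        exact hpos x (Ioo_subset_Ico_self hx)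
    · have hsub : Ici s ⊆ Ici 0 := Ici_subset_Ici.2 hs.le
      refine ((hfam c).strictConcaveOn (convex_Ici s) (by rwa [hI c hc₀c]) fun x hx => ?_).congr
        ((hEq c hc₀c).mono hsub)
      rw [interior_Ici] at hx
      exact hneg x hx
  · intro c hc
    have hc₀c : c₀ < c := hc₀₁.trans_le hc.1
    refine ((hfam c).concaveOn (convex_Ici 0) (hI c hc₀c.le).ge fun x hx => ?_).congr
      (hEq c hc₀c.le)
    rw [interior_Ici] at hx
    have hxT : ∀ x : ℝ, 0 ≤ x → x ∈ interval (lifespan β a b c) := fun x hx => by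
      rw [hI c hc₀c.le]; exact hx
    have hx0 : 0 < x := hx
    rcases hc.2.eq_or_lt with rfl | hc0
    · by_cases hb1 : b = 1
      · subst hb1
        exact ((hfam 0).stationary (hxT x hx0.le)).2.le
      · exact (((hfam 0).regular_of_ge (by linarith) fun h2 => hb1 h2.1).2.1 le_rfl x hx0).le
    · rcases (hfam c).classification hc0 with h1 | h1 | ⟨-, h1 | ⟨y, hy, hpy, -⟩⟩
      · exact absurd (hreg c hc₀c) h1.not_isRegular
      · exact absurd (hreg c hc₀c) h1.not_isRegular
      · exact (h1.1 x hx0.le).le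
      · linarith [hone c hc y (hxT y hy.le)]
  · intro c hc
    have hc0 : c < 0 := hc.2.trans_le hc₁0
    have hc₀c : c₀ ≤ c := hc.1.le
    rcases (hfam c).classification hc0 with h1 | h1 | ⟨-, h1 | ⟨s, hs, -, hneg, -, hpos⟩⟩
    · exact absurd (hreg c hc.1) h1.not_isRegular
    · exact absurd (hreg c hc.1) h1.not_isRegular
    · refine absurd (fun t ht => ?_) (hnot c hc.2)
      rcases ht.1.eq_or_lt with rfl | h0
      · rw [(hfam c).p_zero]; exact hb
      · exact (h1.2 t h0).le
    · refine ⟨s, hs, ?_, ?_⟩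
      · refine ((hfam c).strictConcaveOn (convex_Icc 0 s) ?_ fun x hx => ?_).congr
          ((hEq c hc₀c).mono Icc_subset_Ici_self)
        · rw [hI c hc₀c]; exact Icc_subset_Ici_self
        · rw [interior_Icc] at hx
          exact hneg x (Ioo_subset_Ico_self hx)
      · have hsub : Ici s ⊆ Ici 0 := Ici_subset_Ici.2 hs.le
        refine ((hfam c).strictConvexOn (convex_Ici s) (by rwa [hI c hc₀c]) fun x hx => ?_).congr
          ((hEq c hc₀c).mono hsub)
        rw [interior_Ici] at hx
        exact hpos x hx
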